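/- Let $d\ge 2$ and $0<\alpha\le 1$. A Markov iterated function scheme on $[0,1]$ consists of maps $T_1,\dots,T_d\colon[0,1]\to[0,1]$ and a $d\times d$ matrix $M$ with entries in $\{0,1\}$ such that: (i) each $T_j$ is $C^{1+\alpha}$ (continuously differentiable with $\alpha$-Hölder derivative) and $T_j'(x)\neq 0$ for all $x\in[0,1]$; (ii) the scheme is uniformly contracting: there are $n\ge 1$ and $c<1$ such that every composition $T_{j_1}\circ\cdots\circ T_{j_n}$ is Lipschitz with constant $c$ (with $n=1$: every $T_j$ is a contraction); (iii) open set condition: there are non-empty open sets $U_1,\dots,U_d\subset[0,1]$ such that $T_k(U_k)\subset U_j$ whenever $M(j,k)=1$, and $T_k(U_k)\cap T_l(U_l)=\varnothing$ whenever $k\ne l$ and $M(j,k)=M(j,l)=1$ for some $j$ (with $U_1=\dots=U_d=U$ this is implied by the classical open set condition: the sets $T_jU$ are pairwise disjoint subsets of $U$); (iv) $M$ is aperiodic: there is $n\ge1$ such that all entries of $M^n$ are positive. Its limit set is $$X=\Big\{\lim_{n\to\infty}T_{j_1}\circ\cdots\circ T_{j_n}(0)\ :\ j_k\in\{1,\dots,d\},\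 M(j_k,j_{k+1})=1\text{ for all }k\ge1\Big\}.$$ Let $S$ be the disjoint union of $d$ copies $[0,1]\times\{j\}$ of $[0,1]$, and let $C^\alpha(S)$ be the space of $\underline f=(f_1,\dots,f_d)$ with every $f_j\colon[0,1]\to\mathbb R$ being $\alpha$-Hölder; $\underline f$ is positive if every $f_j$ takes only positive values. For $0\le t\le 1$ the transfer operator is $$(\mathcal L_t\underline f)_k(x)=\sum_{j=1}^d M(j,k)\,f_j(T_jx)\,|T_j'(x)|^t,\qquad 1\le k\le d,\ x\in[0,1].$$ Let $t_0,t_1\in[0,1]$. Then $\dim_H X\in(t_0,t_1)$ if and only if there exist positive $\underline f,\underline g\in C^\alpha(S)$ such that $$\inf_{1\le k\le d}\ \inf_{x\in[0,1]}\frac{(\mathcal L_{t_0}\underline f)_k(x)}{f_k(x)}>1\qquad\text{and}\qquad \sup_{1\le k\le d}\ \sup_{x\in[0,1]}\frac{(\mathcal L_{t_1}\underline g)_k(x)}{g_k(x)}<1 .$$ -/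

import Mathlib

open scoped NNReal ENNReal Topology

noncomputable section

/-- The composition `T (j 0) ∘ T (j 1) ∘ ⋯ ∘ T (j (n - 1))` along a sequence of indices. -/
def compAlong {d : ℕ} (T : Fin d → ℝ → ℝ) (j : ℕ → Fin d) : ℕ → ℝ → ℝ
  | 0 => id
  | n + 1 => compAlong T j n ∘ T (j n)

/-- The derivative of a map of the interval `[0, 1]` (one-sided at the end points). -/
def intervalDeriv (φ : ℝ → ℝ) (x : ℝ) : ℝ :=
  derivWithin φ (Set.Icc (0 : ℝ) 1) x

/-- A Markov iterated function scheme on `[0, 1]`: `C^{1+α}` maps `T 0, …, T (d - 1)` of `[0, 1]`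
into itself with nowhere vanishing derivative, uniformly contracting and satisfying the open set
condition, together with an aperiodic `0`-`1` matrix `M`. -/
structure MarkovIFS (d : ℕ) (α : ℝ≥0) where
  /-- The maps; only their values on `[0, 1]` matter. -/
  T : Fin d → ℝ → ℝ
  /-- The transition matrix. -/
  M : Matrix (Fin d) (Fin d) ℕ
  mapsTo : ∀ j, Set.MapsTo (T j) (Set.Icc 0 1) (Set.Icc 0 1)
  contDiffOn : ∀ j, ContDiffOn ℝ 1 (T j) (Set.Icc 0 1)
  holder_deriv : ∀ j, ∃ C : ℝ≥0, HolderOnWith C α (intervalDeriv (T j)) (Set.Icc 0 1)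
  deriv_ne_zero : ∀ j, ∀ x ∈ Set.Icc (0 : ℝ) 1, intervalDeriv (T j) x ≠ 0
  /-- All `n`-fold compositions contract by a factor `c < 1`, for some `n ≥ 1`. When every `T j` is
  itself a contraction one takes `n = 1`; general `n` admits `x ↦ 1 / (1 + x)`, whose derivative at
  `0` has modulus `1`. -/
  contracting : ∃ n : ℕ, 1 ≤ n ∧ ∃ c : ℝ≥0, c < 1 ∧
    ∀ j : ℕ → Fin d, LipschitzOnWith c (compAlong T j n) (Set.Icc 0 1)
  /-- Open set condition. The usual condition (a non-empty open `V` with the `T j '' V` pairwise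
  disjoint subsets of `V`) is the special case in which all the sets `U j` are equal to `V`. For a
  Markov scheme one only has to look at admissible compositions, so that distinct indices may carry
  the same map. -/
  openSetCondition : ∃ U : Fin d → Set ℝ,
    (∀ j, IsOpen (U j) ∧ (U j).Nonempty ∧ U j ⊆ Set.Icc 0 1) ∧
    (∀ j k, M j k = 1 → T k '' U k ⊆ U j) ∧
    (∀ j k l, M j k = 1 → M j l = 1 → k ≠ l → Disjoint (T k '' U k) (T l '' U l))
  zero_or_one : ∀ j k, M j k = 0 ∨ M j k = 1
  aperiodic : ∃ n : ℕ, 1 ≤ n ∧ ∀ j k, 0 < (M ^ n) j k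

/-- The disjoint union of `d` copies of `[0, 1]`. -/
abbrev Copies (d : ℕ) : Type := Fin d × Set.Icc (0 : ℝ) 1

/-- Membership in `C^α(S)`: each component is `α`-Hölder on its copy of `[0, 1]`. -/
def IsHolderOnCopies {d : ℕ} (α : ℝ≥0) (f : Copies d → ℝ) : Prop :=
  ∀ j, ∃ C : ℝ≥0, HolderWith C α (fun x : Set.Icc (0 : ℝ) 1 => f (j, x))

namespace MarkovIFS

variable {d : ℕ} {α : ℝ≥0}

/-- The limit set: all limits of `T_{j_1} ∘ ⋯ ∘ T_{j_n} (0)` along admissible sequences. -/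
def limitSet (Φ : MarkovIFS d α) : Set ℝ :=
  {x | ∃ j : ℕ → Fin d, (∀ n, Φ.M (j n) (j (n + 1)) = 1) ∧
    Filter.Tendsto (fun n => compAlong Φ.T j n 0) Filter.atTop (𝓝 x)}

/-- The map `T_j` sends the point `x` of any copy of `[0, 1]` to the point `T_j x` of the `j`-th
copy. -/
def copyMap (Φ : MarkovIFS d α) (j : Fin d) (s : Copies d) : Copies d :=
  (j, ⟨Φ.T j s.2, Φ.mapsTo j s.2.2⟩)

/-- The transfer operator
`(L_t f)_k (x) = ∑ j, M(j, k) * f_j (T_j x) * |T_j' x| ^ t`. -/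
def transfer (Φ : MarkovIFS d α) (t : ℝ) (f : Copies d → ℝ) (s : Copies d) : ℝ :=
  ∑ j, (Φ.M j s.1 : ℝ) * f (Φ.copyMap j s) * |intervalDeriv (Φ.T j) s.2| ^ t

end MarkovIFS

end

/-! Everything passes through the partition sums: the sums of `t`-th powers of the sizes of
admissible words of length `n`, the size of a word being the derivative of its composition up to a
constant (bounded distortion, `exists_distortion`). Aperiodicity makes these sums comparable with
the iterates of the transfer operator on the constant `1`, up to a fixed shift in `n` for the lower
bound. No spectral theory is used; two facts link them to dimension.

If the sums at `t` are bounded, the images of `[0,1]` along admissible words are economical covers,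
so the dimension is at most `t` (`dimH_limitSet_le`). If the `t`-dimensional Hausdorff measure
vanishes and `t > 0`, the sums tend to zero (`tendsto_partitionSum`): an efficient cover is replaced
by words of comparable size, the open set condition bounds how many words one covering set needs,
compactness leaves finitely many words of total weight at most `1/2`, and a renewal argument
finishes.

From test functions to dimension: a factor strictly above or below `1` is traded for a small change
of the exponent, which yields strict inequalities (`lt_dimH_limitSet`, `dimH_limitSet_lt`). From
dimension to test functions: some iterate of the operator on `1` is everywhere at least `2`,
respectively at most `1/2`, and a weighted sum of the earlier iterates turns this into a one-step
inequality (`exists_testFunction`). -/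

namespace MarkovIFS

variable {d : ℕ} {α : ℝ≥0} (Φ : MarkovIFS d α)

/-! ### Compositions along words: derivatives, contraction, distortion -/

/-- The composition of the maps of the scheme along a word. -/
def wordMap : List (Fin d) → ℝ → ℝ
  | [], x => x
  | j :: w, x => Φ.T j (wordMap w x)

/-- The modulus of the derivative of the composition along a word. -/
noncomputable def wordDeriv : List (Fin d) → ℝ → ℝ
  | [], _ => 1
  | j :: w, x => |intervalDeriv (Φ.T j) (Φ.wordMap w x)| * wordDeriv w x

/-- A word is admissible if all its transitions are allowed. -/
def Admissible (w : List (Fin d)) : Prop := w.IsChain fun j k => Φ.M j k = 1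

@[simp] lemma wordMap_nil (x : ℝ) : Φ.wordMap [] x = x := rfl

@[simp] lemma wordMap_cons (j : Fin d) (w : List (Fin d)) (x : ℝ) :
    Φ.wordMap (j :: w) x = Φ.T j (Φ.wordMap w x) := rfl

@[simp] lemma wordDeriv_nil (x : ℝ) : Φ.wordDeriv [] x = 1 := rfl

@[simp] lemma wordDeriv_cons (j : Fin d) (w : List (Fin d)) (x : ℝ) :
    Φ.wordDeriv (j :: w) x = |intervalDeriv (Φ.T j) (Φ.wordMap w x)| * Φ.wordDeriv w x := rfl

lemma wordMap_append (w u : List (Fin d)) (x : ℝ) :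
    Φ.wordMap (w ++ u) x = Φ.wordMap w (Φ.wordMap u x) := by
  induction w with
  | nil => rfl
  | cons j w ih => simp [ih]

lemma wordDeriv_append (w u : List (Fin d)) (x : ℝ) :
    Φ.wordDeriv (w ++ u) x = Φ.wordDeriv w (Φ.wordMap u x) * Φ.wordDeriv u x := by
  induction w with
  | nil => simp
  | cons j w ih => simp [ih, wordMap_append, mul_assoc]

lemma wordMap_mem (w : List (Fin d)) {x : ℝ} (hx : x ∈ Set.Icc (0 : ℝ) 1) :
    Φ.wordMap w x ∈ Set.Icc (0 : ℝ) 1 := by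
  induction w with
  | nil => exact hx
  | cons j w ih => exact Φ.mapsTo j ih

lemma wordDeriv_pos (w : List (Fin d)) {x : ℝ} (hx : x ∈ Set.Icc (0 : ℝ) 1) :
    0 < Φ.wordDeriv w x := by
  induction w with
  | nil => simp
  | cons j w ih =>
    exact mul_pos (abs_pos.2 (Φ.deriv_ne_zero j _ (Φ.wordMap_mem w hx))) ih

lemma hasDerivWithinAt_T (j : Fin d) {x : ℝ} (hx : x ∈ Set.Icc (0 : ℝ) 1) :
    HasDerivWithinAt (Φ.T j) (intervalDeriv (Φ.T j) x) (Set.Icc 0 1) x :=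
  ((Φ.contDiffOn j).differentiableOn (by norm_num) x hx).hasDerivWithinAt

lemma exists_hasDerivWithinAt_wordMap (w : List (Fin d)) {x : ℝ} (hx : x ∈ Set.Icc (0 : ℝ) 1) :
    ∃ D, HasDerivWithinAt (Φ.wordMap w) D (Set.Icc 0 1) x ∧ |D| = Φ.wordDeriv w x := by
  induction w with
  | nil => exact ⟨1, hasDerivWithinAt_id x _, by simp⟩
  | cons j w ih =>
    obtain ⟨D, hD, hDw⟩ := ih
    refine ⟨intervalDeriv (Φ.T j) (Φ.wordMap w x) * D, ?_, by rw [abs_mul, hDw]; rfl⟩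
    exact (Φ.hasDerivWithinAt_T j (Φ.wordMap_mem w hx)).comp x hD
      fun y hy => Φ.wordMap_mem w hy

lemma continuousOn_wordMap (w : List (Fin d)) :
    ContinuousOn (Φ.wordMap w) (Set.Icc 0 1) := fun _ hx =>
  let ⟨_, hD, _⟩ := Φ.exists_hasDerivWithinAt_wordMap w hx
  hD.continuousWithinAt

/-- The mean value theorem for compositions of maps of the scheme. -/
lemma exists_abs_wordMap_sub_eq (w : List (Fin d)) {x y : ℝ} (hx : x ∈ Set.Icc (0 : ℝ) 1)
    (hy : y ∈ Set.Icc (0 : ℝ) 1) :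
    ∃ z ∈ Set.Icc (0 : ℝ) 1,
      |Φ.wordMap w x - Φ.wordMap w y| = Φ.wordDeriv w z * |x - y| := by
  wlog hxy : x ≤ y generalizing x y
  · obtain ⟨z, hz, h⟩ := this hy hx (le_of_not_ge hxy)
    exact ⟨z, hz, by rw [abs_sub_comm, h, abs_sub_comm]⟩
  rcases hxy.eq_or_lt with rfl | hlt
  · exact ⟨x, hx, by simp⟩
  have hsub : Set.Icc x y ⊆ Set.Icc 0 1 := Set.Icc_subset_Icc hx.1 hy.2
  have hder : ∀ z ∈ Set.Ioo x y, ∃ D, HasDerivAt (Φ.wordMap w) D z ∧ |D| = Φ.wordDeriv w z := by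
    intro z hz
    obtain ⟨D, hD, hDw⟩ := Φ.exists_hasDerivWithinAt_wordMap w (hsub (Set.Ioo_subset_Icc_self hz))
    exact ⟨D, hD.hasDerivAt (Icc_mem_nhds (hx.1.trans_lt hz.1) (hz.2.trans_le hy.2)), hDw⟩
  obtain ⟨z, hz, h⟩ := exists_deriv_eq_slope (Φ.wordMap w) hlt
    ((Φ.continuousOn_wordMap w).mono hsub) fun z hz =>
      let ⟨_, hD, _⟩ := hder z hz
      hD.differentiableAt.differentiableWithinAt
  obtain ⟨D, hD, hDw⟩ := hder z hz
  refine ⟨z, hsub (Set.Ioo_subset_Icc_self hz), ?_⟩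
  have hne : y - x ≠ 0 := (sub_pos.2 hlt).ne'
  rw [hD.deriv, eq_div_iff hne] at h
  rw [abs_sub_comm, ← h, abs_mul, hDw, abs_sub_comm]

lemma injOn_wordMap (w : List (Fin d)) : Set.InjOn (Φ.wordMap w) (Set.Icc 0 1) := by
  intro x hx y hy hxy
  obtain ⟨z, hz, h⟩ := Φ.exists_abs_wordMap_sub_eq w hx hy
  rw [hxy, sub_self, abs_zero, eq_comm, mul_eq_zero] at h
  exact sub_eq_zero.1 (abs_eq_zero.1 (h.resolve_left (Φ.wordDeriv_pos w hz).ne'))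

lemma exists_deriv_bounds : ∃ θ Θ : ℝ, 0 < θ ∧ 1 ≤ Θ ∧
    ∀ j, ∀ x ∈ Set.Icc (0 : ℝ) 1,
      θ ≤ |intervalDeriv (Φ.T j) x| ∧ |intervalDeriv (Φ.T j) x| ≤ Θ := by
  have hcont : ∀ j, ContinuousOn (fun x => |intervalDeriv (Φ.T j) x|) (Set.Icc 0 1) := fun j =>
    ((Φ.contDiffOn j).continuousOn_derivWithin (uniqueDiffOn_Icc one_pos) (by norm_num)).abs
  have h : ∀ j, ∃ θ Θ : ℝ, 0 < θ ∧ ∀ x ∈ Set.Icc (0 : ℝ) 1,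
      θ ≤ |intervalDeriv (Φ.T j) x| ∧ |intervalDeriv (Φ.T j) x| ≤ Θ := by
    intro j
    have hne : (Set.Icc (0 : ℝ) 1).Nonempty := ⟨0, by simp⟩
    obtain ⟨a, ha, hamin⟩ := isCompact_Icc.exists_isMinOn hne (hcont j)
    obtain ⟨b, hb, hbmax⟩ := isCompact_Icc.exists_isMaxOn hne (hcont j)
    exact ⟨_, _, abs_pos.2 (Φ.deriv_ne_zero j a ha), fun x hx => ⟨hamin hx, hbmax hx⟩⟩
  choose θ Θ hθ hb using h
  obtain ⟨a, ha⟩ := (Set.finite_range fun j => (θ j)⁻¹).bddAbove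
  obtain ⟨b, hb'⟩ := (Set.finite_range Θ).bddAbove
  have hm : 0 < max a 1 := lt_max_of_lt_right one_pos
  refine ⟨(max a 1)⁻¹, max b 1, inv_pos.2 hm,
    le_max_right _ _, fun j x hx => ⟨?_, ?_⟩⟩
  · refine le_trans ?_ (hb j x hx).1
    exact inv_le_of_inv_le₀ (hθ j) ((ha ⟨j, rfl⟩).trans (le_max_left _ _))
  · exact (hb j x hx).2.trans ((hb' ⟨j, rfl⟩).trans (le_max_left _ _))

lemma compAlong_eq_wordMap (σ : ℕ → Fin d) (n : ℕ) :
    compAlong Φ.T σ n = Φ.wordMap ((List.range n).map σ) := by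
  induction n with
  | zero => rfl
  | succ n ih =>
    funext x
    simp [compAlong, ih, List.range_succ, wordMap_append]

lemma exists_map_range_eq (w : List (Fin d)) (k : Fin d) :
    ∃ σ : ℕ → Fin d, (List.range w.length).map σ = w :=
  ⟨fun i => w.getD i k, by
    apply List.ext_getElem <;> simp +contextual⟩

/-- Split off blocks of `n` letters, each contracting by `c`; the fewer than `n` letters left over
expand by at most `Θ ^ n`. The rate per letter is the `n`-th root of the block factor. -/
lemma exists_contraction [Nonempty (Fin d)] : ∃ C ρ : ℝ, 0 < C ∧ 0 < ρ ∧ ρ < 1 ∧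
    ∀ w : List (Fin d), ∀ x ∈ Set.Icc (0 : ℝ) 1, ∀ y ∈ Set.Icc (0 : ℝ) 1,
      |Φ.wordMap w x - Φ.wordMap w y| ≤ C * ρ ^ w.length * |x - y| := by
  obtain ⟨n, hn, c, hc, hlip⟩ := Φ.contracting
  obtain ⟨θ, Θ, -, hΘ, hb⟩ := Φ.exists_deriv_bounds
  have hsingle : ∀ w : List (Fin d), ∀ x ∈ Set.Icc (0 : ℝ) 1, ∀ y ∈ Set.Icc (0 : ℝ) 1,
      |Φ.wordMap w x - Φ.wordMap w y| ≤ Θ ^ w.length * |x - y| := by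
    intro w x hx y hy
    obtain ⟨z, hz, h⟩ := Φ.exists_abs_wordMap_sub_eq w hx hy
    rw [h]
    refine mul_le_mul_of_nonneg_right ?_ (abs_nonneg _)
    clear h
    induction w with
    | nil => simp
    | cons j w ih =>
      rw [wordDeriv_cons, List.length_cons, pow_succ']
      exact mul_le_mul (hb j _ (Φ.wordMap_mem w hz)).2 ih (Φ.wordDeriv_pos w hz).le
        (zero_le_one.trans hΘ)
  have hn0 : n ≠ 0 := by omega
  -- The maximum with `1 / 2` keeps `ρ` positive without discussing `c = 0`.
  set c' : ℝ := max c (1 / 2) with hc'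
  have hc'0 : 0 < c' := lt_max_of_lt_right (by norm_num)
  have hc'1 : c' < 1 := max_lt (by exact_mod_cast hc) (by norm_num)
  set ρ : ℝ := c' ^ (1 / (n : ℝ)) with hρ
  have hρ0 : 0 < ρ := Real.rpow_pos_of_pos hc'0 _
  have hρ1 : ρ < 1 := Real.rpow_lt_one hc'0.le hc'1 (by positivity)
  have hρn : ρ ^ n = c' := by
    rw [hρ, one_div, Real.rpow_inv_natCast_pow hc'0.le hn0]
  refine ⟨Θ ^ n / ρ ^ n, ρ, by positivity, hρ0, hρ1, fun w => ?_⟩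
  induction hw : w.length using Nat.strong_induction_on generalizing w with
  | _ N ih =>
    intro x hx y hy
    rcases lt_or_ge N n with hlt | hge
    · refine (hsingle w x hx y hy).trans (mul_le_mul_of_nonneg_right ?_ (abs_nonneg _))
      rw [hw, div_mul_eq_mul_div, le_div_iff₀ (by positivity)]
      exact mul_le_mul (pow_le_pow_right₀ hΘ hlt.le)
        (pow_le_pow_of_le_one hρ0.le hρ1.le hlt.le) (by positivity) (by positivity)
    · obtain ⟨σ, hσ⟩ := exists_map_range_eq (w.take n) (Classical.arbitrary _)
      have hlen : (w.take n).length = n := by simp; omega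
      rw [hlen] at hσ
      have h1 := hlip σ
      rw [compAlong_eq_wordMap, hσ] at h1
      have h2 := h1.dist_le_mul _ (Φ.wordMap_mem (w.drop n) hx) _ (Φ.wordMap_mem (w.drop n) hy)
      rw [← wordMap_append, ← wordMap_append, List.take_append_drop, Real.dist_eq,
        Real.dist_eq] at h2
      have h3 := ih (N - n) (by omega) (w.drop n) (by simp; omega) x hx y hy
      have hN : ρ ^ N = c' * ρ ^ (N - n) := by
        rw [← hρn, ← pow_add]; congr 1; omega
      rw [hN]
      calc _ ≤ (c : ℝ) * |Φ.wordMap (w.drop n) x - Φ.wordMap (w.drop n) y| := h2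
        _ ≤ c' * (Θ ^ n / ρ ^ n * ρ ^ (N - n) * |x - y|) := by
          gcongr
          exact le_max_left _ _
        _ = _ := by ring

/-- By the chain rule the ratio of derivatives is a product over letters. The arguments of a letter
followed by `i` others are at distance at most `C * ρ ^ i`, so Hölder continuity bounds its ratio by
`exp (A * r ^ i)`, and the exponents form a convergent geometric series. -/
lemma exists_distortion [Nonempty (Fin d)] (hα : 0 < α) : ∃ K : ℝ, 1 ≤ K ∧
    ∀ w : List (Fin d), ∀ x ∈ Set.Icc (0 : ℝ) 1, ∀ y ∈ Set.Icc (0 : ℝ) 1,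
      Φ.wordDeriv w x ≤ K * Φ.wordDeriv w y := by
  obtain ⟨C, ρ, hC, hρ0, hρ1, hcon⟩ := Φ.exists_contraction
  obtain ⟨θ, Θ, hθ, -, hb⟩ := Φ.exists_deriv_bounds
  choose H hH using Φ.holder_deriv
  obtain ⟨B, hB⟩ := (Set.finite_range fun j => (H j : ℝ)).bddAbove
  have hB0 : 0 ≤ B := (NNReal.coe_nonneg _).trans (hB ⟨Classical.arbitrary _, rfl⟩)
  have hα' : (0 : ℝ) < α := hα
  set r : ℝ := ρ ^ (α : ℝ) with hr
  have hr0 : 0 < r := Real.rpow_pos_of_pos hρ0 _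
  have hr1 : r < 1 := Real.rpow_lt_one hρ0.le hρ1 hα'
  set A : ℝ := B * C ^ (α : ℝ) / θ with hA
  have hA0 : 0 ≤ A := by positivity
  have hstep : ∀ j, ∀ w : List (Fin d), ∀ x ∈ Set.Icc (0 : ℝ) 1, ∀ y ∈ Set.Icc (0 : ℝ) 1,
      |intervalDeriv (Φ.T j) (Φ.wordMap w x)| ≤
        |intervalDeriv (Φ.T j) (Φ.wordMap w y)| * Real.exp (A * r ^ w.length) := by
    intro j w x hx y hy
    have hx' := Φ.wordMap_mem w hx
    have hy' := Φ.wordMap_mem w hy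
    have h1 := (hH j).dist_le hx' hy'
    rw [Real.dist_eq, Real.dist_eq] at h1
    have hxy : |x - y| ≤ 1 := by
      rw [abs_le]; constructor <;> linarith [hx.1, hx.2, hy.1, hy.2]
    have h2 : |Φ.wordMap w x - Φ.wordMap w y| ≤ C * ρ ^ w.length :=
      (hcon w x hx y hy).trans (mul_le_of_le_one_right (by positivity) hxy)
    have h3 : |Φ.wordMap w x - Φ.wordMap w y| ^ (α : ℝ) ≤ C ^ (α : ℝ) * r ^ w.length := by
      refine (Real.rpow_le_rpow (abs_nonneg _) h2 hα'.le).trans_eq ?_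
      rw [Real.mul_rpow hC.le (by positivity), ← Real.rpow_natCast, ← Real.rpow_mul hρ0.le,
        mul_comm (w.length : ℝ), Real.rpow_mul hρ0.le, Real.rpow_natCast]
    have h4 : |intervalDeriv (Φ.T j) (Φ.wordMap w x)| -
        |intervalDeriv (Φ.T j) (Φ.wordMap w y)| ≤ B * (C ^ (α : ℝ) * r ^ w.length) :=
      (abs_sub_abs_le_abs_sub _ _).trans (h1.trans (mul_le_mul (hB ⟨j, rfl⟩) h3 (by positivity) hB0))
    have h5 : B * (C ^ (α : ℝ) * r ^ w.length) = θ * (A * r ^ w.length) := by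
      rw [hA]; field_simp
    have h6 := (hb j _ hy').1
    have h7 := Real.add_one_le_exp (A * r ^ w.length)
    have h8 : 0 ≤ A * r ^ w.length := by positivity
    -- With `b` the derivative at the second point: `b + θ * (A * r ^ n) ≤ b * (1 + A * r ^ n)`,
    -- because `θ ≤ b`, and then `1 + u ≤ exp u`.
    nlinarith [mul_le_mul_of_nonneg_right h6 h8, mul_le_mul_of_nonneg_left h7 (hθ.le.trans h6)]
  have hmain : ∀ w : List (Fin d), ∀ x ∈ Set.Icc (0 : ℝ) 1, ∀ y ∈ Set.Icc (0 : ℝ) 1,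
      Φ.wordDeriv w x ≤ Real.exp (A * ∑ i ∈ Finset.range w.length, r ^ i) * Φ.wordDeriv w y := by
    intro w x hx y hy
    induction w with
    | nil => simp
    | cons j w ih =>
      rw [List.length_cons, Finset.sum_range_succ, mul_add, Real.exp_add, wordDeriv_cons,
        wordDeriv_cons]
      refine (mul_le_mul (hstep j w x hx y hy) ih (Φ.wordDeriv_pos w hx).le
        (by positivity)).trans_eq (by ring)
  refine ⟨Real.exp (A * (1 - r)⁻¹), Real.one_le_exp
    (mul_nonneg hA0 (inv_nonneg.2 (sub_nonneg.2 hr1.le))), fun w x hx y hy =>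
    (hmain w x hx y hy).trans (mul_le_mul_of_nonneg_right ?_ (Φ.wordDeriv_pos w hy).le)⟩
  gcongr
  rw [← tsum_geometric_of_lt_one hr0.le hr1]
  exact (summable_geometric_of_lt_one hr0.le hr1).sum_le_tsum _ fun i _ => by positivity

end MarkovIFS

/-! ### Words of a given length and prefixes of sequences -/

/-- The finite set of words of length `n`. -/
noncomputable def wordsOfLength (d n : ℕ) : Finset (List (Fin d)) :=
  (List.finite_length_eq (Fin d) n).toFinset

@[simp] lemma mem_wordsOfLength {d n : ℕ} {w : List (Fin d)} :
    w ∈ wordsOfLength d n ↔ w.length = n := by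
  simp [wordsOfLength]

lemma sum_wordsOfLength_zero {d : ℕ} (F : List (Fin d) → ℝ) :
    ∑ w ∈ wordsOfLength d 0, F w = F [] := by
  have : wordsOfLength d 0 = {[]} := by ext w; simp
  rw [this, Finset.sum_singleton]

lemma sum_wordsOfLength_one {d : ℕ} (F : List (Fin d) → ℝ) :
    ∑ w ∈ wordsOfLength d 1, F w = ∑ j, F [j] := by
  symm
  refine Finset.sum_bij (fun j _ => [j]) (by simp) (by simp) ?_ (by simp)
  intro w hw
  obtain ⟨j, rfl⟩ := List.length_eq_one_iff.1 (mem_wordsOfLength.1 hw)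
  exact ⟨j, Finset.mem_univ _, rfl⟩

lemma sum_wordsOfLength_add {d : ℕ} (m n : ℕ) (F : List (Fin d) → ℝ) :
    ∑ w ∈ wordsOfLength d (m + n), F w =
      ∑ v ∈ wordsOfLength d m, ∑ u ∈ wordsOfLength d n, F (v ++ u) := by
  rw [← Finset.sum_product']
  symm
  refine Finset.sum_nbij' (fun p => p.1 ++ p.2) (fun w => (w.take m, w.drop m)) ?_ ?_ ?_ ?_ ?_
  · rintro ⟨v, u⟩ h
    simp only [Finset.mem_product, mem_wordsOfLength] at h
    simp [h.1, h.2]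
  · intro w h
    simp only [mem_wordsOfLength] at h
    simp [h]
  · rintro ⟨v, u⟩ h
    simp only [Finset.mem_product, mem_wordsOfLength] at h
    simp [← h.1]
  · simp
  · simp

/-- The word formed by the first `n` letters of a sequence. -/
def prefixWord {d : ℕ} (σ : ℕ → Fin d) (n : ℕ) : List (Fin d) := (List.range n).map σ

@[simp] lemma length_prefixWord {d : ℕ} (σ : ℕ → Fin d) (n : ℕ) : (prefixWord σ n).length = n := by
  simp [prefixWord]

lemma prefixWord_succ {d : ℕ} (σ : ℕ → Fin d) (n : ℕ) :
    prefixWord σ (n + 1) = prefixWord σ n ++ [σ n] := by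
  simp [prefixWord, List.range_succ]

lemma prefixWord_succ' {d : ℕ} (σ : ℕ → Fin d) (n : ℕ) :
    prefixWord σ (n + 1) = σ 0 :: prefixWord (fun i => σ (i + 1)) n := by
  simp [prefixWord, List.range_succ_eq_map, Function.comp_def]

lemma prefixWord_add {d : ℕ} (σ : ℕ → Fin d) (m n : ℕ) :
    prefixWord σ (m + n) = prefixWord σ m ++ prefixWord (fun i => σ (m + i)) n := by
  simp [prefixWord, List.range_add, Function.comp_def]

lemma prefixWord_congr {d : ℕ} {σ τ : ℕ → Fin d} {n : ℕ} (h : ∀ i < n, σ i = τ i) :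
    prefixWord σ n = prefixWord τ n := by
  simpa [prefixWord] using h

/-! ### Word sizes, weights and admissible sequences -/

namespace MarkovIFS

variable {d : ℕ} {α : ℝ≥0} (Φ : MarkovIFS d α)

/-- The set of admissible sequences. -/
def shiftSpace : Set (ℕ → Fin d) := {σ | ∀ n, Φ.M (σ n) (σ (n + 1)) = 1}

/-- A constant that controls the distortion of all compositions of maps of the scheme. -/
def IsDistortionConst (K : ℝ) : Prop :=
  1 ≤ K ∧ ∀ w : List (Fin d), ∀ x ∈ Set.Icc (0 : ℝ) 1, ∀ y ∈ Set.Icc (0 : ℝ) 1,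
    Φ.wordDeriv w x ≤ K * Φ.wordDeriv w y

/-- The size of a word: an upper bound for the derivative of the composition along it, which is
sharp up to a constant. -/
noncomputable def wordSize (K : ℝ) (w : List (Fin d)) : ℝ := K * Φ.wordDeriv w 0

open Classical in
/-- The weight of a word with respect to an exponent. -/
noncomputable def wordWeight (K t : ℝ) (w : List (Fin d)) : ℝ :=
  if Φ.Admissible w then Φ.wordSize K w ^ t else 0

/-- The sum of the weights of all words of a given length. -/
noncomputable def partitionSum (K t : ℝ) (n : ℕ) : ℝ :=
  ∑ w ∈ wordsOfLength d n, Φ.wordWeight K t w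

lemma zero_mem_Icc : (0 : ℝ) ∈ Set.Icc (0 : ℝ) 1 := by simp

variable {Φ} {K t : ℝ}

lemma IsDistortionConst.pos (hK : Φ.IsDistortionConst K) : 0 < K := one_pos.trans_le hK.1

lemma IsDistortionConst.wordSize_pos (hK : Φ.IsDistortionConst K) (w : List (Fin d)) :
    0 < Φ.wordSize K w := mul_pos hK.pos (Φ.wordDeriv_pos w zero_mem_Icc)

lemma IsDistortionConst.wordDeriv_le (hK : Φ.IsDistortionConst K) (w : List (Fin d)) {x : ℝ}
    (hx : x ∈ Set.Icc (0 : ℝ) 1) : Φ.wordDeriv w x ≤ Φ.wordSize K w :=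
  hK.2 w x hx 0 zero_mem_Icc

lemma IsDistortionConst.wordSize_le (hK : Φ.IsDistortionConst K) (w : List (Fin d)) {x : ℝ}
    (hx : x ∈ Set.Icc (0 : ℝ) 1) : Φ.wordSize K w ≤ K ^ 2 * Φ.wordDeriv w x := by
  rw [sq, mul_assoc]
  exact mul_le_mul_of_nonneg_left (hK.2 w 0 zero_mem_Icc x hx) hK.pos.le

/-- The factor `K` in `wordSize` absorbs the distortion, so that submultiplicativity holds without a
constant, as the renewal argument requires. -/
lemma IsDistortionConst.wordSize_append_le (hK : Φ.IsDistortionConst K) (w u : List (Fin d)) :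
    Φ.wordSize K (w ++ u) ≤ Φ.wordSize K w * Φ.wordSize K u := by
  rw [wordSize, wordDeriv_append, mul_left_comm, ← wordSize]
  exact mul_le_mul_of_nonneg_right (hK.wordDeriv_le w (Φ.wordMap_mem u zero_mem_Icc))
    (hK.wordSize_pos u).le

lemma IsDistortionConst.abs_sub_le (hK : Φ.IsDistortionConst K) (w : List (Fin d)) {x y : ℝ}
    (hx : x ∈ Set.Icc (0 : ℝ) 1) (hy : y ∈ Set.Icc (0 : ℝ) 1) :
    |Φ.wordMap w x - Φ.wordMap w y| ≤ Φ.wordSize K w * |x - y| := by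
  obtain ⟨z, hz, h⟩ := Φ.exists_abs_wordMap_sub_eq w hx hy
  rw [h]
  exact mul_le_mul_of_nonneg_right (hK.wordDeriv_le w hz) (abs_nonneg _)

lemma IsDistortionConst.le_abs_sub (hK : Φ.IsDistortionConst K) (w : List (Fin d)) {x y : ℝ}
    (hx : x ∈ Set.Icc (0 : ℝ) 1) (hy : y ∈ Set.Icc (0 : ℝ) 1) :
    Φ.wordSize K w * |x - y| ≤ K ^ 2 * |Φ.wordMap w x - Φ.wordMap w y| := by
  obtain ⟨z, hz, h⟩ := Φ.exists_abs_wordMap_sub_eq w hx hy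
  rw [h, ← mul_assoc]
  exact mul_le_mul_of_nonneg_right (hK.wordSize_le w hz) (abs_nonneg _)

lemma IsDistortionConst.exists_wordSize_le [Nonempty (Fin d)] (hK : Φ.IsDistortionConst K) :
    ∃ C ρ : ℝ, 0 < C ∧ 0 < ρ ∧ ρ < 1 ∧
      ∀ w : List (Fin d), Φ.wordSize K w ≤ C * ρ ^ w.length := by
  obtain ⟨C, ρ, hC, hρ0, hρ1, h⟩ := Φ.exists_contraction
  refine ⟨K ^ 2 * C, ρ, mul_pos (pow_pos hK.pos 2) hC, hρ0, hρ1, fun w => ?_⟩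
  have h0 : (1 : ℝ) ∈ Set.Icc (0 : ℝ) 1 := by simp
  have h1 := hK.le_abs_sub w zero_mem_Icc h0
  have h2 := h w 0 zero_mem_Icc 1 h0
  simp only [zero_sub, abs_neg, abs_one, mul_one] at h1 h2
  rw [mul_assoc]
  exact h1.trans (mul_le_mul_of_nonneg_left h2 (by positivity))

lemma IsDistortionConst.wordWeight_nonneg (hK : Φ.IsDistortionConst K) (w : List (Fin d)) :
    0 ≤ Φ.wordWeight K t w := by
  rw [wordWeight]
  split_ifs
  · exact Real.rpow_nonneg (hK.wordSize_pos w).le _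
  · exact le_rfl

lemma IsDistortionConst.wordWeight_append_le (hK : Φ.IsDistortionConst K) (ht : 0 ≤ t)
    (w u : List (Fin d)) :
    Φ.wordWeight K t (w ++ u) ≤ Φ.wordWeight K t w * Φ.wordWeight K t u := by
  by_cases h : Φ.Admissible (w ++ u)
  · have hw : Φ.Admissible w := List.IsChain.left_of_append h
    have hu : Φ.Admissible u := List.IsChain.right_of_append h
    rw [wordWeight, wordWeight, wordWeight, if_pos h, if_pos hw, if_pos hu,
      ← Real.mul_rpow (hK.wordSize_pos w).le (hK.wordSize_pos u).le]
    exact Real.rpow_le_rpow (hK.wordSize_pos _).le (hK.wordSize_append_le w u) ht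
  · rw [wordWeight, if_neg h]
    exact mul_nonneg (hK.wordWeight_nonneg w) (hK.wordWeight_nonneg u)

variable (Φ)

lemma exists_admissible_of_pow_pos (n : ℕ) (a k : Fin d) (h : 0 < (Φ.M ^ (n + 1)) a k) :
    ∃ u : List (Fin d), u.length = n ∧ Φ.Admissible (a :: (u ++ [k])) := by
  induction n generalizing a with
  | zero =>
    refine ⟨[], rfl, ?_⟩
    rw [zero_add, pow_one] at h
    simpa [Admissible] using (Φ.zero_or_one a k).resolve_left h.ne'
  | succ n ih =>
    rw [pow_succ', Matrix.mul_apply] at h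
    obtain ⟨b, -, hb⟩ := Finset.exists_ne_zero_of_sum_ne_zero h.ne'
    obtain ⟨u, hu, hadm⟩ := ih b (Nat.pos_of_ne_zero (right_ne_zero_of_mul hb))
    refine ⟨b :: u, by simp [hu], ?_⟩
    exact List.isChain_cons_cons.2
      ⟨(Φ.zero_or_one a b).resolve_left (left_ne_zero_of_mul hb), hadm⟩

/-- One length serves all pairs of letters; this is what lets words of length `n` be compared with
words of the single length `n + m`. -/
lemma exists_connecting_length : ∃ m : ℕ, ∀ a k : Fin d,
    ∃ u : List (Fin d), u.length = m ∧ Φ.Admissible (a :: (u ++ [k])) := by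
  obtain ⟨n, hn, h⟩ := Φ.aperiodic
  refine ⟨n - 1, fun a k => Φ.exists_admissible_of_pow_pos _ a k ?_⟩
  rw [Nat.sub_add_cancel hn]
  exact h a k

lemma exists_successor (a : Fin d) : ∃ k, Φ.M a k = 1 := by
  obtain ⟨m, hm⟩ := Φ.exists_connecting_length
  obtain ⟨u, -, h⟩ := hm a a
  cases u with
  | nil => exact ⟨a, (List.isChain_cons_cons.1 h).1⟩
  | cons b u => exact ⟨b, (List.isChain_cons_cons.1 h).1⟩

lemma exists_predecessor (k : Fin d) : ∃ a, Φ.M a k = 1 := by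
  obtain ⟨m, hm⟩ := Φ.exists_connecting_length
  obtain ⟨u, -, h⟩ := hm k k
  rcases List.eq_nil_or_concat u with rfl | ⟨v, b, rfl⟩
  · exact ⟨k, (List.isChain_cons_cons.1 h).1⟩
  · refine ⟨b, ?_⟩
    have : Φ.Admissible ((k :: v) ++ ([b, k])) := by simpa using h
    exact (List.isChain_cons_cons.1 (List.IsChain.right_of_append this)).1

lemma exists_shiftSpace_prefixWord_cons (a : Fin d) (w : List (Fin d)) (hw : Φ.Admissible (a :: w)) :
    ∃ σ ∈ Φ.shiftSpace, prefixWord σ (a :: w).length = a :: w := by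
  choose next hnext using Φ.exists_successor
  induction w generalizing a with
  | nil =>
    refine ⟨fun n => next^[n] a, fun n => ?_, rfl⟩
    simp only [Function.iterate_succ_apply']
    exact hnext _
  | cons b w ih =>
    obtain ⟨hab, hbw⟩ := List.isChain_cons_cons.1 hw
    obtain ⟨σ, hσ, hpre⟩ := ih b hbw
    refine ⟨fun n => Nat.casesOn n a σ, fun n => ?_, ?_⟩
    · cases n with
      | zero =>
        rw [List.length_cons, prefixWord_succ'] at hpre
        have : σ 0 = b := (List.cons.inj hpre).1
        simpa [this] using hab
      | succ n => exact hσ n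
    · rw [List.length_cons, prefixWord_succ']
      simpa using hpre

lemma exists_shiftSpace_prefixWord [Nonempty (Fin d)] (w : List (Fin d)) (hw : Φ.Admissible w) :
    ∃ σ ∈ Φ.shiftSpace, prefixWord σ w.length = w := by
  cases w with
  | nil =>
    obtain ⟨σ, hσ, -⟩ := Φ.exists_shiftSpace_prefixWord_cons (Classical.arbitrary _) []
      (List.isChain_singleton _)
    exact ⟨σ, hσ, rfl⟩
  | cons a w => exact Φ.exists_shiftSpace_prefixWord_cons a w hw

variable {Φ}

lemma admissible_prefixWord {σ : ℕ → Fin d} (hσ : σ ∈ Φ.shiftSpace) (n : ℕ) :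
    Φ.Admissible (prefixWord σ n) := by
  rw [Admissible, List.isChain_iff_getElem]
  intro i hi
  simpa [prefixWord] using hσ i

/-- All later approximants lie in the image along the prefix, which is compact and hence closed. -/
lemma mem_image_wordMap_of_tendsto {σ : ℕ → Fin d} {x : ℝ}
    (hx : Filter.Tendsto (fun n => compAlong Φ.T σ n 0) Filter.atTop (𝓝 x)) (n : ℕ) :
    x ∈ Φ.wordMap (prefixWord σ n) '' Set.Icc 0 1 := by
  have hclosed : IsClosed (Φ.wordMap (prefixWord σ n) '' Set.Icc 0 1) :=
    (isCompact_Icc.image_of_continuousOn (Φ.continuousOn_wordMap _)).isClosed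
  refine hclosed.mem_of_tendsto hx ?_
  filter_upwards [Filter.eventually_ge_atTop n] with m hm
  obtain ⟨k, rfl⟩ := Nat.exists_eq_add_of_le hm
  rw [compAlong_eq_wordMap, ← prefixWord, prefixWord_add, wordMap_append]
  exact ⟨_, Φ.wordMap_mem _ zero_mem_Icc, rfl⟩

variable (Φ)

lemma exists_tendsto_compAlong [Nonempty (Fin d)] (σ : ℕ → Fin d) :
    ∃ x, Filter.Tendsto (fun n => compAlong Φ.T σ n 0) Filter.atTop (𝓝 x) := by
  obtain ⟨C, ρ, hC, hρ0, hρ1, h⟩ := Φ.exists_contraction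
  refine cauchySeq_tendsto_of_complete (cauchySeq_of_le_geometric ρ C hρ1 fun n => ?_)
  have hT := Φ.mapsTo (σ n) zero_mem_Icc
  have h1 := h (prefixWord σ n) 0 zero_mem_Icc _ hT
  rw [length_prefixWord] at h1
  have h2 : compAlong Φ.T σ (n + 1) 0 = Φ.wordMap (prefixWord σ n) (Φ.T (σ n) 0) := by
    simp [compAlong, compAlong_eq_wordMap, prefixWord]
  rw [h2, compAlong_eq_wordMap, ← prefixWord, Real.dist_eq]
  refine h1.trans (mul_le_of_le_one_right (by positivity) ?_)
  rw [zero_sub, abs_neg, abs_of_nonneg hT.1]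
  exact hT.2

end MarkovIFS

/-! ### Upper bound for the dimension from bounded partition sums -/

namespace MarkovIFS

variable {d : ℕ} {α : ℝ≥0} {Φ : MarkovIFS d α} {K t : ℝ}

/-- If the partition sums at `t` are bounded, then the limit set has dimension at most `t`. -/
lemma IsDistortionConst.dimH_limitSet_le [Nonempty (Fin d)] (hK : Φ.IsDistortionConst K)
    (t : ℝ≥0) (B : ℝ) (hB : ∀ n, Φ.partitionSum K t n ≤ B) : dimH Φ.limitSet ≤ t := by
  classical
  obtain ⟨C, ρ, hC, hρ0, hρ1, hsize⟩ := hK.exists_wordSize_le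
  let ι : ℕ → Type := fun n => {w // w ∈ (wordsOfLength d n).filter Φ.Admissible}
  let S : ∀ n, ι n → Set ℝ := fun n w => Φ.wordMap w.1 '' Set.Icc 0 1
  have hdiam : ∀ w : List (Fin d),
      Metric.ediam (Φ.wordMap w '' Set.Icc 0 1) ≤ ENNReal.ofReal (Φ.wordSize K w) := by
    intro w
    refine Metric.ediam_le ?_
    rintro _ ⟨x, hx, rfl⟩ _ ⟨y, hy, rfl⟩
    rw [edist_dist, Real.dist_eq]
    refine ENNReal.ofReal_le_ofReal ((hK.abs_sub_le w hx hy).trans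
      (mul_le_of_le_one_right (hK.wordSize_pos w).le ?_))
    rw [abs_le]; constructor <;> linarith [hx.1, hx.2, hy.1, hy.2]
  refine dimH_le_of_hausdorffMeasure_ne_top (ne_top_of_le_ne_top
    (ENNReal.ofReal_ne_top (r := B)) ?_)
  refine (MeasureTheory.Measure.hausdorffMeasure_le_liminf_sum (ι := ι) (t : ℝ) Φ.limitSet
    (l := Filter.atTop) (fun n => ENNReal.ofReal (C * ρ ^ n)) ?_ S ?_ ?_).trans ?_
  · rw [← ENNReal.ofReal_zero]
    refine ENNReal.tendsto_ofReal ?_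
    simpa using (tendsto_pow_atTop_nhds_zero_of_lt_one hρ0.le hρ1).const_mul C
  · refine Filter.Eventually.of_forall fun n w => (hdiam w.1).trans (ENNReal.ofReal_le_ofReal ?_)
    have := hsize w.1
    rwa [mem_wordsOfLength.1 (Finset.mem_filter.1 w.2).1] at this
  · refine Filter.Eventually.of_forall fun n x hx => ?_
    obtain ⟨σ, hσ, hlim⟩ := hx
    exact Set.mem_iUnion.2 ⟨⟨prefixWord σ n, Finset.mem_filter.2
      ⟨by simp, admissible_prefixWord hσ n⟩⟩, mem_image_wordMap_of_tendsto hlim n⟩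
  · refine Filter.liminf_le_of_frequently_le' (Filter.Frequently.of_forall fun n => ?_)
    calc ∑ w : ι n, Metric.ediam (S n w) ^ (t : ℝ)
        ≤ ∑ w : ι n, ENNReal.ofReal (Φ.wordSize K w.1 ^ (t : ℝ)) := by
          refine Finset.sum_le_sum fun w _ => ?_
          rw [← ENNReal.ofReal_rpow_of_pos (hK.wordSize_pos _)]
          exact ENNReal.rpow_le_rpow (hdiam w.1) t.2
      _ = ENNReal.ofReal (∑ w : ι n, Φ.wordSize K w.1 ^ (t : ℝ)) :=
          (ENNReal.ofReal_sum_of_nonneg fun w _ =>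
            Real.rpow_nonneg (hK.wordSize_pos _).le _).symm
      _ ≤ ENNReal.ofReal B := by
          refine ENNReal.ofReal_le_ofReal (le_trans (le_of_eq ?_) (hB n))
          rw [Finset.sum_coe_sort ((wordsOfLength d n).filter Φ.Admissible)
            (fun w => Φ.wordSize K w ^ (t : ℝ)), Finset.sum_filter]
          simp only [partitionSum, wordWeight]

end MarkovIFS

/-! ### Efficient covers and the renewal argument -/

open MeasureTheory in
/-- A set of zero Hausdorff measure has countable covers with small sums of powers of bounds of
the diameters, where these bounds are positive. -/
lemma exists_cover_of_hausdorffMeasure_eq_zero {s : Set ℝ} {t : ℝ} (ht : 0 < t)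
    (hs : μH[t] s = 0) {ε : ℝ} (hε : 0 < ε) :
    ∃ (E : ℕ → Set ℝ) (r : ℕ → ℝ), (∀ i, 0 < r i) ∧ s ⊆ ⋃ i, E i ∧
      (∀ i, ∀ x ∈ E i, ∀ y ∈ E i, |x - y| ≤ r i) ∧
      ∀ F : Finset ℕ, ∑ i ∈ F, r i ^ t ≤ ε := by
  rw [Measure.hausdorffMeasure_apply] at hs
  simp only [ENNReal.iSup_eq_zero] at hs
  -- Covers of mesh at most `1` suffice: the mesh is used only to make the diameters finite.
  have h1 := (hs 1 one_pos).trans_lt (ENNReal.ofReal_pos.2 (half_pos hε))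
  simp only [iInf_lt_iff] at h1
  obtain ⟨E, hcov, hE1, hsum⟩ := h1
  have hfin : ∀ i, Metric.ediam (E i) ≠ ∞ := fun i => ne_top_of_le_ne_top ENNReal.one_ne_top (hE1 i)
  -- Positive terms of total `ε / 2`. They pay for replacing diameters that may vanish by positive
  -- numbers `r i`.
  set e : ℕ → ℝ := fun i => (ε / 2 / 2 / 2 ^ i) with he
  have he0 : ∀ i, 0 < e i := fun i => by positivity
  have hdE : ∀ i, ENNReal.ofReal (Metric.diam (E i) ^ t) ≤
      ⨆ _ : (E i).Nonempty, Metric.ediam (E i) ^ t := by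
    intro i
    rcases (E i).eq_empty_or_nonempty with h | h
    · simp [h, Real.zero_rpow ht.ne']
    · rw [iSup_pos h, ← ENNReal.ofReal_rpow_of_nonneg Metric.diam_nonneg ht.le, Metric.diam,
        ENNReal.ofReal_toReal (hfin i)]
  refine ⟨E, fun i => max (Metric.diam (E i)) (e i ^ (1 / t)),
    fun i => lt_max_of_lt_right (Real.rpow_pos_of_pos (he0 i) _), hcov,
    fun i x hx y hy => ?_, fun F => ?_⟩
  · refine le_max_of_le_left ?_
    rw [← Real.dist_eq]
    exact Metric.dist_le_diam_of_mem' (hfin i) hx hy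
  · have hle : ∀ i, max (Metric.diam (E i)) (e i ^ (1 / t)) ^ t ≤ Metric.diam (E i) ^ t + e i := by
      intro i
      have h2 : (e i ^ (1 / t)) ^ t = e i := by
        rw [← Real.rpow_mul (he0 i).le, one_div_mul_cancel ht.ne', Real.rpow_one]
      rcases max_choice (Metric.diam (E i)) (e i ^ (1 / t)) with h | h <;> rw [h]
      · linarith [he0 i]
      · rw [h2]
        linarith [Real.rpow_nonneg (Metric.diam_nonneg (s := E i)) t]
    have h3 : ∑ i ∈ F, Metric.diam (E i) ^ t ≤ ε / 2 := by
      rw [← ENNReal.ofReal_le_ofReal_iff (half_pos hε).le, ENNReal.ofReal_sum_of_nonneg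
        fun i _ => Real.rpow_nonneg Metric.diam_nonneg _]
      exact (Finset.sum_le_sum fun i _ => hdE i).trans ((ENNReal.sum_le_tsum F).trans hsum.le)
    have h4 : ∑ i ∈ F, e i ≤ ε / 2 := by
      have := hasSum_geometric_two' (ε / 2)
      exact sum_le_hasSum F (fun i _ => (he0 i).le) this
    calc _ ≤ ∑ i ∈ F, (Metric.diam (E i) ^ t + e i) := Finset.sum_le_sum fun i _ => hle i
      _ ≤ ε := by rw [Finset.sum_add_distrib]; linarith

/-- A renewal argument: a submultiplicative weight on words which has small sum on a finite set of
words that contains a prefix of every sufficiently long word of positive weight has sums over the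
words of given length that tend to zero. -/
lemma tendsto_sum_wordsOfLength_zero {d : ℕ} (q : List (Fin d) → ℝ) (hq0 : ∀ w, 0 ≤ q w)
    (hq : ∀ w u, q (w ++ u) ≤ q w * q u) (A : Finset (List (Fin d))) (hA : [] ∉ A)
    (hsum : ∑ v ∈ A, q v ≤ 1 / 2) (N₀ : ℕ) (hlen : ∀ v ∈ A, v.length ≤ N₀)
    (hpre : ∀ w : List (Fin d), N₀ ≤ w.length → q w ≠ 0 → ∃ v ∈ A, v <+: w) :
    Filter.Tendsto (fun n => ∑ w ∈ wordsOfLength d n, q w) Filter.atTop (𝓝 0) := by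
  classical
  set Z : ℕ → ℝ := fun n => ∑ w ∈ wordsOfLength d n, q w with hZ
  have hZ0 : ∀ n, 0 ≤ Z n := fun n => Finset.sum_nonneg fun w _ => hq0 w
  -- The renewal inequality: each word of positive weight is cut after a prefix `v ∈ A`, and
  -- submultiplicativity separates the two pieces.
  have hstep : ∀ N, N₀ ≤ N → Z N ≤ ∑ v ∈ A, q v * Z (N - v.length) := by
    intro N hN
    calc Z N ≤ ∑ w ∈ wordsOfLength d N, ∑ v ∈ A, if v <+: w then q w else 0 := by
          refine Finset.sum_le_sum fun w hw => ?_
          by_cases h0 : q w = 0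
          · rw [h0]; exact Finset.sum_nonneg fun v _ => by simp
          obtain ⟨v, hv, hvw⟩ := hpre w (by rw [mem_wordsOfLength.1 hw]; exact hN) h0
          have := Finset.single_le_sum (f := fun v => if v <+: w then q w else 0)
            (fun v _ => by split_ifs; exacts [hq0 w, le_rfl]) hv
          simpa [hvw] using this
      _ = ∑ v ∈ A, ∑ w ∈ wordsOfLength d N, if v <+: w then q w else 0 := Finset.sum_comm
      _ ≤ ∑ v ∈ A, q v * Z (N - v.length) := by
          refine Finset.sum_le_sum fun v hv => ?_
          have hN' : N = v.length + (N - v.length) := by have := hlen v hv; omega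
          rw [hN', sum_wordsOfLength_add, Finset.sum_eq_single v, Nat.add_sub_cancel_left,
            hZ, Finset.mul_sum]
          · exact Finset.sum_le_sum fun u _ => by simpa using hq v u
          · intro v' hv' hne
            refine Finset.sum_eq_zero fun u _ => if_neg fun h => hne ?_
            rw [mem_wordsOfLength] at hv'
            exact ((List.prefix_of_prefix_length_le h (List.prefix_append v' u) hv'.ge).eq_of_length
              hv'.symm).symm
          · intro h; simp at h
  rcases A.eq_empty_or_nonempty with rfl | ⟨v₀, hv₀⟩
  · refine tendsto_const_nhds.congr' ?_
    filter_upwards [Filter.eventually_ge_atTop N₀] with n hn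
    exact le_antisymm (hZ0 n) (by simpa using hstep n hn)
  have hN₀ : 0 < N₀ := lt_of_lt_of_le
    (List.length_pos_iff.2 fun h => hA (h ▸ hv₀)) (hlen v₀ hv₀)
  set B : ℝ := ∑ n ∈ Finset.range N₀, Z n with hB
  have hB0 : 0 ≤ B := Finset.sum_nonneg fun n _ => hZ0 n
  -- Each renewal step goes back at most `N₀` and gains a factor `1 / 2`.
  have hbound : ∀ n, Z n ≤ B * (1 / 2) ^ (n / N₀) := by
    intro n
    induction n using Nat.strong_induction_on with
    | _ n ih =>
      rcases lt_or_ge n N₀ with hlt | hge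
      · rw [Nat.div_eq_of_lt hlt, pow_zero, mul_one]
        exact Finset.single_le_sum (f := Z) (fun n _ => hZ0 n) (Finset.mem_range.2 hlt)
      · have h1 : ∀ v ∈ A, Z (n - v.length) ≤ B * (1 / 2) ^ (n / N₀ - 1) := by
          intro v hv
          have hv0 : 0 < v.length := List.length_pos_iff.2 fun h => hA (h ▸ hv)
          refine (ih (n - v.length) (by omega)).trans (mul_le_mul_of_nonneg_left
            (pow_le_pow_of_le_one (by norm_num) (by norm_num) ?_) hB0)
          rw [Nat.le_div_iff_mul_le hN₀, Nat.sub_mul, one_mul]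
          have := Nat.div_mul_le_self n N₀
          have := hlen v hv
          omega
        calc Z n ≤ ∑ v ∈ A, q v * Z (n - v.length) := hstep n hge
          _ ≤ ∑ v ∈ A, q v * (B * (1 / 2) ^ (n / N₀ - 1)) :=
            Finset.sum_le_sum fun v hv => mul_le_mul_of_nonneg_left (h1 v hv) (hq0 v)
          _ = (∑ v ∈ A, q v) * (B * (1 / 2) ^ (n / N₀ - 1)) := (Finset.sum_mul _ _ _).symm
          _ ≤ 1 / 2 * (B * (1 / 2) ^ (n / N₀ - 1)) :=
            mul_le_mul_of_nonneg_right hsum (by positivity)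
          _ = B * (1 / 2) ^ (n / N₀) := by
            obtain ⟨k, hk⟩ := Nat.exists_eq_add_of_lt (Nat.div_pos hge hN₀)
            rw [hk]; simp only [Nat.zero_add, Nat.add_sub_cancel, pow_succ]; ring
  refine squeeze_zero hZ0 hbound ?_
  have : Filter.Tendsto (fun n => (1 / 2 : ℝ) ^ (n / N₀)) Filter.atTop (𝓝 0) :=
    (tendsto_pow_atTop_nhds_zero_of_lt_one (by norm_num) (by norm_num)).comp
      (Nat.tendsto_div_const_atTop hN₀.ne')
  simpa using this.const_mul B

/-! ### The open set condition and counting of words -/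

namespace MarkovIFS

variable {d : ℕ} {α : ℝ≥0} (Φ : MarkovIFS d α) {K t : ℝ}

/-- The image of the set attached to the last letter of a word under the composition along it. -/
def cylinder (U : Fin d → Set ℝ) : List (Fin d) → Set ℝ
  | [] => ∅
  | [j] => Φ.T j '' U j
  | j :: k :: w => Φ.T j '' cylinder U (k :: w)

variable {Φ}

lemma exists_cylinder_eq (U : Fin d → Set ℝ) (j : Fin d) (w : List (Fin d)) :
    ∃ k, Φ.cylinder U (j :: w) = Φ.wordMap (j :: w) '' U k := by
  induction w generalizing j with
  | nil => exact ⟨j, rfl⟩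
  | cons k w ih =>
    obtain ⟨l, hl⟩ := ih k
    refine ⟨l, ?_⟩
    rw [cylinder, hl, Set.image_image]
    rfl

lemma cylinder_subset {U : Fin d → Set ℝ} (hU : ∀ j k, Φ.M j k = 1 → Φ.T k '' U k ⊆ U j)
    (j : Fin d) (w : List (Fin d)) (hw : Φ.Admissible (j :: w)) :
    Φ.cylinder U (j :: w) ⊆ Φ.T j '' U j := by
  induction w generalizing j with
  | nil => exact subset_rfl
  | cons k w ih =>
    obtain ⟨hjk, hw⟩ := List.isChain_cons_cons.1 hw
    exact Set.image_mono ((ih k hw).trans (hU j k hjk))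

/-- Injectivity of the maps strips common letters until the words diverge, where the open set
condition applies. It only compares successors of a common index, hence the common first letter `j`.
-/
lemma disjoint_cylinder {U : Fin d → Set ℝ} (hUI : ∀ j, U j ⊆ Set.Icc 0 1)
    (hU : ∀ j k, Φ.M j k = 1 → Φ.T k '' U k ⊆ U j)
    (hdisj : ∀ j k l, Φ.M j k = 1 → Φ.M j l = 1 → k ≠ l → Disjoint (Φ.T k '' U k) (Φ.T l '' U l))
    (j : Fin d) (w u : List (Fin d)) (hw : Φ.Admissible (j :: w)) (hu : Φ.Admissible (j :: u))
    (hwu : ¬ w <+: u) (huw : ¬ u <+: w) :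
    Disjoint (Φ.cylinder U (j :: w)) (Φ.cylinder U (j :: u)) := by
  induction w generalizing j u with
  | nil => exact absurd List.nil_prefix hwu
  | cons k w ih =>
    cases u with
    | nil => exact absurd List.nil_prefix huw
    | cons l u =>
      obtain ⟨hjk, hw⟩ := List.isChain_cons_cons.1 hw
      obtain ⟨hjl, hu⟩ := List.isChain_cons_cons.1 hu
      have hsub : ∀ k w, Φ.M j k = 1 → Φ.Admissible (k :: w) →
          Φ.cylinder U (k :: w) ⊆ Set.Icc 0 1 := fun k w hjk hw =>
        (cylinder_subset hU k w hw).trans ((hU j k hjk).trans (hUI j))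
      have hdis : Disjoint (Φ.cylinder U (k :: w)) (Φ.cylinder U (l :: u)) := by
        rcases eq_or_ne k l with rfl | hkl
        · refine ih k u hw hu ?_ ?_
          · simpa using hwu
          · simpa using huw
        · exact (hdisj j k l hjk hjl hkl).mono (cylinder_subset hU k w hw)
            (cylinder_subset hU l u hu)
      rw [cylinder, cylinder, Set.disjoint_left]
      rintro _ ⟨x, hx, rfl⟩ ⟨y, hy, hxy⟩
      have := Φ.injOn_wordMap [j] (hsub l u hjl hu hy) (hsub k w hjk hw hx) hxy
      exact Set.disjoint_left.1 hdis hx (this ▸ hy)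

open MeasureTheory in
/-- The open set condition bounds the number of incomparable words of comparable size that meet a
set of this diameter. -/
lemma IsDistortionConst.exists_card_le (hK : Φ.IsDistortionConst K) {κ : ℝ} (hκ : 0 < κ) :
    ∃ Q : ℝ, 0 ≤ Q ∧ ∀ (r : ℝ) (E : Set ℝ), 0 < r → (∀ x ∈ E, ∀ y ∈ E, |x - y| ≤ r) →
      ∀ F : Finset (List (Fin d)),
        (∀ w ∈ F, w ≠ [] ∧ Φ.Admissible w ∧ κ * r ≤ Φ.wordSize K w ∧ Φ.wordSize K w ≤ r ∧
          (Φ.wordMap w '' Set.Icc 0 1 ∩ E).Nonempty) →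
        (∀ w ∈ F, ∀ u ∈ F, w <+: u → w = u) → (F.card : ℝ) ≤ Q := by
  classical
  obtain ⟨U, hU, hsub, hdisj⟩ := Φ.openSetCondition
  have hint : ∀ k, ∃ a b : ℝ, a < b ∧ Set.Icc a b ⊆ U k := by
    intro k
    obtain ⟨hop, ⟨x, hx⟩, -⟩ := hU k
    obtain ⟨ε, hε, hball⟩ := Metric.isOpen_iff.1 hop x hx
    refine ⟨x - ε / 2, x + ε / 2, by linarith, fun y hy => hball ?_⟩
    rw [Metric.mem_ball, Real.dist_eq, abs_lt]
    constructor <;> linarith [hy.1, hy.2]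
  choose a b hab hIcc using hint
  -- `δ` will be a common lower bound for the lengths of the intervals inside the `U k`.
  obtain ⟨c, hc⟩ := (Set.finite_range fun k => (b k - a k)⁻¹).bddAbove
  set δ : ℝ := (max c 1)⁻¹ with hδ
  have hδ0 : 0 < δ := inv_pos.2 (lt_max_of_lt_right one_pos)
  have hδab : ∀ k, δ ≤ b k - a k := fun k =>
    inv_le_of_inv_le₀ (sub_pos.2 (hab k)) ((hc ⟨k, rfl⟩).trans (le_max_left _ _))
  have hK0 := hK.pos
  set Q : ℝ := 4 * K ^ 2 / (κ * δ) with hQ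
  have hQ0 : 0 ≤ Q := by positivity
  refine ⟨d * Q, by positivity, fun r E hr hE F hF hinc => ?_⟩
  -- Disjointness is available only for words with the same first letter, so these are counted
  -- separately, at the price of a factor `d`.
  have hletter : ∀ j : Fin d, ((F.filter fun w => w.head? = some j).card : ℝ) ≤ Q := by
    intro j
    set G := F.filter fun w => w.head? = some j with hG
    have hGF : ∀ w ∈ G, w ∈ F := fun w hw => (Finset.mem_filter.1 hw).1
    have hGj : ∀ w ∈ G, ∃ v, w = j :: v := fun w hw =>
      List.head?_eq_some_iff.1 (Finset.mem_filter.1 hw).2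
    rcases G.eq_empty_or_nonempty with h | ⟨w₀, hw₀⟩
    · simp [h, hQ0]
    have hk : ∀ w : List (Fin d), ∃ k, w ∈ G → Φ.cylinder U w = Φ.wordMap w '' U k := by
      intro w
      by_cases hw : w ∈ G
      · obtain ⟨v, rfl⟩ := hGj w hw
        obtain ⟨k, hk⟩ := Φ.exists_cylinder_eq U j v
        exact ⟨k, fun _ => hk⟩
      · exact ⟨j, fun h => absurd h hw⟩
    choose k hk using hk
    have hJI : ∀ k, Set.Icc (a k) (b k) ⊆ Set.Icc 0 1 := fun k => (hIcc k).trans (hU k).2.2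
    set S : List (Fin d) → Set ℝ := fun w => Φ.wordMap w '' Set.Icc (a (k w)) (b (k w)) with hS
    have hScyl : ∀ w ∈ G, S w ⊆ Φ.cylinder U w := fun w hw => by
      rw [hk w hw]; exact Set.image_mono (hIcc _)
    have hcont : ∀ w, ContinuousOn (Φ.wordMap w) (Set.Icc (a (k w)) (b (k w))) := fun w =>
      (Φ.continuousOn_wordMap w).mono (hJI _)
    have hSmeas : ∀ w ∈ G, MeasurableSet (S w) := fun w _ =>
      (isCompact_Icc.image_of_continuousOn (hcont w)).measurableSet
    have hSdisj : Set.PairwiseDisjoint (G : Set (List (Fin d))) S := by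
      intro w hw u hu hne
      refine Disjoint.mono (hScyl w hw) (hScyl u hu) ?_
      have h1 := hinc w (hGF w hw) u (hGF u hu)
      have h2 := hinc u (hGF u hu) w (hGF w hw)
      have h3 := (hF w (hGF w hw)).2.1
      have h4 := (hF u (hGF u hu)).2.1
      obtain ⟨w, rfl⟩ := hGj w hw
      obtain ⟨u, rfl⟩ := hGj u hu
      refine disjoint_cylinder (fun j => (hU j).2.2) hsub hdisj j w u h3 h4 ?_ ?_
      · exact fun h => hne (h1 ((List.prefix_cons_inj j).2 h))
      · exact fun h => hne (h2 ((List.prefix_cons_inj j).2 h)).symm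
    obtain ⟨z, hz⟩ := (hF w₀ (hGF w₀ hw₀)).2.2.2.2
    -- Each full image has diameter at most `r` and meets `E`, which also has diameter at most `r`.
    -- Disjoint sets of length at least `m` must thus fit into length `4 * r`.
    have hSsub : ∀ w ∈ G, S w ⊆ Set.Icc (z - 2 * r) (z + 2 * r) := by
      rintro w hw _ ⟨x, hx, rfl⟩
      obtain ⟨-, -, -, hle, ⟨y, ⟨x', hx', rfl⟩, hyE⟩⟩ := hF w (hGF w hw)
      have h1 := hK.abs_sub_le w (hJI _ hx) hx'
      have h2 : |x - x'| ≤ 1 := by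
        have := hJI _ hx
        rw [abs_le]; constructor <;> linarith [hx'.1, hx'.2, this.1, this.2]
      have h3 : Φ.wordSize K w * |x - x'| ≤ r :=
        (mul_le_of_le_one_right (hK.wordSize_pos w).le h2).trans hle
      have h4 := abs_le.1 (h1.trans h3)
      have h5 := abs_le.1 (hE _ hyE _ hz.2)
      constructor <;> linarith [h4.1, h4.2, h5.1, h5.2]
    set m : ℝ := κ * δ / K ^ 2 * r with hm
    have hm0 : 0 < m := by positivity
    have hSvol : ∀ w ∈ G, ENNReal.ofReal m ≤ volume (S w) := by
      intro w hw
      have h1 : Set.uIcc (Φ.wordMap w (a (k w))) (Φ.wordMap w (b (k w))) ⊆ S w := by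
        have := intermediate_value_uIcc (f := Φ.wordMap w) (a := a (k w)) (b := b (k w))
          (by rw [Set.uIcc_of_le (hab _).le]; exact hcont w)
        rwa [Set.uIcc_of_le (hab _).le] at this
      refine le_trans ?_ (measure_mono h1)
      rw [Real.volume_interval]
      refine ENNReal.ofReal_le_ofReal ?_
      have h2 := hK.le_abs_sub w (hJI _ (Set.right_mem_Icc.2 (hab (k w)).le))
        (hJI _ (Set.left_mem_Icc.2 (hab (k w)).le))
      rw [abs_of_pos (sub_pos.2 (hab (k w)))] at h2
      have h3 : κ * r * δ ≤ Φ.wordSize K w * (b (k w) - a (k w)) :=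
        mul_le_mul (hF w (hGF w hw)).2.2.1 (hδab _) hδ0.le (hK.wordSize_pos w).le
      rw [hm, div_mul_eq_mul_div, div_le_iff₀ (by positivity)]
      linarith
    have hvol : (G.card : ℝ≥0∞) * ENNReal.ofReal m ≤ ENNReal.ofReal (4 * r) := by
      calc (G.card : ℝ≥0∞) * ENNReal.ofReal m = ∑ _w ∈ G, ENNReal.ofReal m := by
            rw [Finset.sum_const, nsmul_eq_mul]
        _ ≤ ∑ w ∈ G, volume (S w) := Finset.sum_le_sum hSvol
        _ = volume (⋃ w ∈ G, S w) := (measure_biUnion_finset hSdisj hSmeas).symm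
        _ ≤ volume (Set.Icc (z - 2 * r) (z + 2 * r)) :=
            measure_mono (Set.iUnion₂_subset hSsub)
        _ = ENNReal.ofReal (4 * r) := by rw [Real.volume_Icc]; congr 1; ring
    rw [← ENNReal.ofReal_natCast, ← ENNReal.ofReal_mul (by positivity),
      ENNReal.ofReal_le_ofReal_iff (by positivity), hm] at hvol
    rw [hQ, le_div_iff₀ (by positivity)]
    have h6 : (G.card : ℝ) * (κ * δ) * r ≤ 4 * K ^ 2 * r := by
      have h7 := mul_le_mul_of_nonneg_right hvol (pow_pos hK0 2).le
      have h8 : (G.card : ℝ) * (κ * δ / K ^ 2 * r) * K ^ 2 = G.card * (κ * δ) * r := by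
        field_simp
      linarith
    exact le_of_mul_le_mul_right h6 hr
  have hcover : F ⊆ Finset.univ.biUnion fun j : Fin d => F.filter fun w => w.head? = some j := by
    intro w hw
    obtain ⟨j, v, rfl⟩ := List.exists_cons_of_ne_nil (hF w hw).1
    exact Finset.mem_biUnion.2 ⟨j, Finset.mem_univ _, Finset.mem_filter.2 ⟨hw, rfl⟩⟩
  calc (F.card : ℝ) ≤ ∑ j : Fin d, ((F.filter fun w => w.head? = some j).card : ℝ) := by
        exact_mod_cast (Finset.card_le_card hcover).trans Finset.card_biUnion_le
    _ ≤ ∑ _j : Fin d, Q := Finset.sum_le_sum fun j _ => hletter j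
    _ = d * Q := by simp

end MarkovIFS

/-! ### Decay of the partition sums when the Hausdorff measure vanishes -/

lemma eq_prefixWord_of_prefix {d : ℕ} {σ : ℕ → Fin d} {n : ℕ} {v : List (Fin d)}
    (h : v <+: prefixWord σ n) : v = prefixWord σ v.length := by
  obtain ⟨u, hu⟩ := h
  have hn : n = v.length + u.length := by rw [← List.length_append, hu, length_prefixWord]
  rw [hn, prefixWord_add] at hu
  exact (List.append_inj hu (by simp)).1

lemma eventually_prefixWord_eq {d : ℕ} (σ : ℕ → Fin d) (n : ℕ) :
    ∀ᶠ τ in 𝓝 σ, prefixWord τ n = prefixWord σ n := by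
  have h : ∀ᶠ τ in 𝓝 σ, ∀ i ∈ Set.Iio n, τ i = σ i :=
    (Filter.eventually_all_finite (Set.finite_Iio n)).2 fun i _ =>
      ((continuous_apply i).tendsto σ).eventually (p := (· = σ i)) (by simp)
  exact h.mono fun τ hτ => prefixWord_congr hτ

namespace MarkovIFS

variable {d : ℕ} {α : ℝ≥0} (Φ : MarkovIFS d α) {K t : ℝ}

lemma isCompact_shiftSpace : IsCompact Φ.shiftSpace := by
  have : Φ.shiftSpace = ⋂ n, {σ : ℕ → Fin d | Φ.M (σ n) (σ (n + 1)) = 1} := by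
    ext σ; simp [shiftSpace]
  rw [this]
  refine (isClosed_iInter fun n => ?_).isCompact
  exact (isClosed_discrete {p : Fin d × Fin d | Φ.M p.1 p.2 = 1}).preimage
    (f := fun σ : ℕ → Fin d => (σ n, σ (n + 1))) (by fun_prop)

variable {Φ}

/-- Derivatives are bounded away from zero, so one letter cannot shrink a word too much: a word
stopped when its size first drops to `r` still has size at least `κ * r`. -/
lemma IsDistortionConst.exists_wordSize_append_ge (hK : Φ.IsDistortionConst K) :
    ∃ κ : ℝ, 0 < κ ∧ ∀ (w : List (Fin d)) (j : Fin d),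
      κ * Φ.wordSize K w ≤ Φ.wordSize K (w ++ [j]) := by
  obtain ⟨θ, Θ, hθ, -, hb⟩ := Φ.exists_deriv_bounds
  have hK0 := hK.pos
  refine ⟨θ / K, by positivity, fun w j => ?_⟩
  have h1 := hK.2 w 0 zero_mem_Icc _ (Φ.mapsTo j zero_mem_Icc)
  have h2 := (hb j 0 zero_mem_Icc).1
  have h3 := Φ.wordDeriv_pos w (Φ.mapsTo j zero_mem_Icc)
  rw [wordSize, wordSize, wordDeriv_append]
  simp only [wordMap_cons, wordMap_nil, wordDeriv_cons, wordDeriv_nil, mul_one]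
  calc θ / K * (K * Φ.wordDeriv w 0) = Φ.wordDeriv w 0 * θ := by field_simp
    _ ≤ (K * Φ.wordDeriv w (Φ.T j 0)) * |intervalDeriv (Φ.T j) 0| :=
      mul_le_mul h1 h2 hθ.le (by positivity)
    _ = _ := by ring

/-- If the limit set has zero `t`-dimensional Hausdorff measure, then the partition sums at `t`
tend to zero. -/
lemma IsDistortionConst.tendsto_partitionSum [Nonempty (Fin d)] (hK : Φ.IsDistortionConst K)
    (ht : 0 < t) (h : MeasureTheory.Measure.hausdorffMeasure t Φ.limitSet = 0) :
    Filter.Tendsto (Φ.partitionSum K t) Filter.atTop (𝓝 0) := by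
  classical
  obtain ⟨κ, hκ0, hκ⟩ := hK.exists_wordSize_append_ge
  obtain ⟨C, ρ, hC, hρ0, hρ1, hsize⟩ := hK.exists_wordSize_le
  obtain ⟨Q, hQ0, hQ⟩ := hK.exists_card_le hκ0
  -- Small enough that `Q * ε ≤ 1 / 2`, the total weight allowed by the renewal argument, and that
  -- every `r i < 1`, so that the empty word, of size `K ≥ 1`, is never a cut.
  set ε : ℝ := (1 / 2) / (Q + 1) with hε
  have hε0 : 0 < ε := by positivity
  have hε1 : ε < 1 := by
    rw [hε, div_lt_one (by positivity)]; linarith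
  have hQε : Q * ε ≤ 1 / 2 := by
    rw [hε, mul_div_assoc', div_le_iff₀ (by positivity)]; linarith
  obtain ⟨E, r, hr0, hcov, hE, hsum⟩ := exists_cover_of_hausdorffMeasure_eq_zero ht h hε0
  have hr1 : ∀ i, r i < 1 := by
    intro i
    by_contra! hcon
    have h1 := hsum {i}
    rw [Finset.sum_singleton] at h1
    linarith [Real.one_le_rpow hcon ht.le]
  -- A cut for `i` is a word whose image meets `E i` and whose size is at most `r i` while all its
  -- proper prefixes are larger. Hence distinct cuts for the same `i` are incomparable.
  let isCut : ℕ → List (Fin d) → Prop := fun i w =>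
    (w ≠ [] ∧ Φ.Admissible w ∧ κ * r i ≤ Φ.wordSize K w ∧ Φ.wordSize K w ≤ r i ∧
      (Φ.wordMap w '' Set.Icc 0 1 ∩ E i).Nonempty) ∧
    ∀ v, v <+: w → v ≠ w → r i < Φ.wordSize K v
  have hcut : ∀ σ : ℕ → Fin d, ∃ i n, σ ∈ Φ.shiftSpace → isCut i (prefixWord σ n) := by
    intro σ
    by_cases hσ : σ ∈ Φ.shiftSpace
    swap
    · exact ⟨0, 0, fun h => absurd h hσ⟩
    obtain ⟨x, hx⟩ := Φ.exists_tendsto_compAlong σ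
    obtain ⟨i, hi⟩ := Set.mem_iUnion.1 (hcov ⟨σ, hσ, hx⟩)
    have hex : ∃ n, Φ.wordSize K (prefixWord σ n) ≤ r i := by
      have h1 : Filter.Tendsto (fun n => C * ρ ^ n) Filter.atTop (𝓝 0) := by
        simpa using (tendsto_pow_atTop_nhds_zero_of_lt_one hρ0.le hρ1).const_mul C
      obtain ⟨n, hn⟩ := (h1.eventually_lt_const (hr0 i)).exists
      refine ⟨n, (hsize _).trans ?_⟩
      rw [length_prefixWord]
      exact hn.le
    set n := Nat.find hex with hn
    have hspec : Φ.wordSize K (prefixWord σ n) ≤ r i := Nat.find_spec hex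
    have hmin : ∀ m < n, r i < Φ.wordSize K (prefixWord σ m) := fun m hm =>
      not_le.1 (Nat.find_min hex hm)
    have hn0 : n ≠ 0 := by
      intro h0
      rw [h0] at hspec
      have : Φ.wordSize K (prefixWord σ 0) = K := by simp [wordSize, prefixWord]
      linarith [hr1 i, hK.1]
    refine ⟨i, n, fun _ => ⟨⟨?_, admissible_prefixWord hσ n, ?_, hspec,
      ⟨x, mem_image_wordMap_of_tendsto hx n, hi⟩⟩, ?_⟩⟩
    · intro h0
      exact hn0 (by simpa using congrArg List.length h0)
    · obtain ⟨m, hm⟩ := Nat.exists_eq_succ_of_ne_zero hn0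
      rw [hm, Nat.succ_eq_add_one, prefixWord_succ]
      exact (mul_le_mul_of_nonneg_left (hmin m (by omega)).le hκ0.le).trans (hκ _ _)
    · intro v hv hne
      have h1 := eq_prefixWord_of_prefix hv
      have h2 : v.length < n := by
        refine lt_of_le_of_ne (by simpa using hv.length_le) fun h3 => hne ?_
        rw [h1, h3]
      rw [h1]
      exact hmin _ h2
  choose ind len hcut using hcut
  -- By compactness, finitely many cuts already provide a prefix of every admissible sequence.
  obtain ⟨S, hS, hcovS⟩ := Φ.isCompact_shiftSpace.elim_nhds_subcover
    (fun σ => {τ | prefixWord τ (len σ) = prefixWord σ (len σ)})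
    fun σ _ => eventually_prefixWord_eq σ (len σ)
  set A : Finset (List (Fin d)) := S.image fun σ => prefixWord σ (len σ) with hA
  have hcutA : ∀ w : List (Fin d), ∃ i, w ∈ A → isCut i w := by
    intro w
    by_cases hw : w ∈ A
    · obtain ⟨σ, hσ, rfl⟩ := Finset.mem_image.1 hw
      exact ⟨ind σ, fun _ => hcut σ (hS σ hσ)⟩
    · exact ⟨0, fun h => absurd h hw⟩
  choose ι hι using hcutA
  refine tendsto_sum_wordsOfLength_zero _ (fun w => hK.wordWeight_nonneg w)
    (hK.wordWeight_append_le ht.le) A (fun h0 => (hι _ h0).1.1 rfl) ?_ (S.sup len) ?_ ?_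
  · have hweight : ∀ w ∈ A, Φ.wordWeight K t w ≤ r (ι w) ^ t := by
      intro w hw
      obtain ⟨⟨-, hadm, -, hle, -⟩, -⟩ := hι w hw
      rw [wordWeight, if_pos hadm]
      exact Real.rpow_le_rpow (hK.wordSize_pos w).le hle ht.le
    -- Each covering set is charged at most `Q` times, so the weight of `A` is at most `Q` times the
    -- sum of the cover.
    have hcard : ∀ i, ((A.filter fun w => ι w = i).card : ℝ) ≤ Q := by
      intro i
      have hi : ∀ w ∈ A.filter fun w => ι w = i, isCut i w := by
        intro w hw
        obtain ⟨hwA, rfl⟩ := Finset.mem_filter.1 hw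
        exact hι w hwA
      refine hQ (r i) (E i) (hr0 i) (hE i) _ (fun w hw => (hi w hw).1) fun w hw u hu hwu => ?_
      by_contra hne
      exact (lt_irrefl _) (((hi u hu).2 w hwu hne).trans_le (hi w hw).1.2.2.2.1)
    calc ∑ w ∈ A, Φ.wordWeight K t w ≤ ∑ w ∈ A, r (ι w) ^ t := Finset.sum_le_sum hweight
      _ = ∑ i ∈ A.image ι, ∑ w ∈ A with ι w = i, r (ι w) ^ t :=
        (Finset.sum_fiberwise_of_maps_to (fun w hw => Finset.mem_image_of_mem ι hw) _).symm
      _ ≤ ∑ i ∈ A.image ι, Q * r i ^ t := by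
        refine Finset.sum_le_sum fun i _ => ?_
        rw [Finset.sum_congr rfl (g := fun _ => r i ^ t)
          fun w hw => by rw [(Finset.mem_filter.1 hw).2], Finset.sum_const, nsmul_eq_mul]
        exact mul_le_mul_of_nonneg_right (hcard i) (Real.rpow_nonneg (hr0 i).le _)
      _ = Q * ∑ i ∈ A.image ι, r i ^ t := (Finset.mul_sum _ _ _).symm
      _ ≤ Q * ε := mul_le_mul_of_nonneg_left (hsum _) hQ0
      _ ≤ 1 / 2 := hQε
  · intro v hv
    obtain ⟨σ, hσ, rfl⟩ := Finset.mem_image.1 hv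
    rw [length_prefixWord]
    exact Finset.le_sup hσ
  · intro w hlen hw
    have hadm : Φ.Admissible w := by
      by_contra hcon
      exact hw (if_neg hcon)
    obtain ⟨τ, hτ, hτw⟩ := Φ.exists_shiftSpace_prefixWord w hadm
    obtain ⟨σ, hσ, hστ⟩ := Set.mem_iUnion₂.1 (hcovS hτ)
    refine ⟨_, Finset.mem_image_of_mem _ hσ, ?_⟩
    obtain ⟨k, hk⟩ := Nat.exists_eq_add_of_le ((Finset.le_sup (f := len) hσ).trans hlen)
    rw [← hτw, hk, prefixWord_add, ← (show prefixWord τ (len σ) = _ from hστ)]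
    exact List.prefix_append _ _

end MarkovIFS

/-! ### Iterates of the transfer operator compared with partition sums -/

namespace MarkovIFS

variable {d : ℕ} {α : ℝ≥0} (Φ : MarkovIFS d α) {K t : ℝ}

lemma transfer_mono {f g : Copies d → ℝ} (h : ∀ s, f s ≤ g s) (s : Copies d) :
    Φ.transfer t f s ≤ Φ.transfer t g s := by
  refine Finset.sum_le_sum fun j _ => mul_le_mul_of_nonneg_right
    (mul_le_mul_of_nonneg_left (h _) (Nat.cast_nonneg _)) (by positivity)

lemma transfer_nonneg {f : Copies d → ℝ} (h : ∀ s, 0 ≤ f s) (s : Copies d) :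
    0 ≤ Φ.transfer t f s :=
  Finset.sum_nonneg fun j _ => mul_nonneg (mul_nonneg (Nat.cast_nonneg _) (h _)) (by positivity)

lemma transfer_const_mul (c : ℝ) (f : Copies d → ℝ) (s : Copies d) :
    Φ.transfer t (fun s => c * f s) s = c * Φ.transfer t f s := by
  rw [transfer, transfer, Finset.mul_sum]
  exact Finset.sum_congr rfl fun j _ => by ring

lemma transfer_sum {ι : Type*} (F : Finset ι) (f : ι → Copies d → ℝ) (s : Copies d) :
    Φ.transfer t (fun s => ∑ i ∈ F, f i s) s = ∑ i ∈ F, Φ.transfer t (f i) s := by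
  simp only [transfer]
  rw [Finset.sum_comm]
  exact Finset.sum_congr rfl fun j _ => by rw [Finset.mul_sum, Finset.sum_mul]

/-- The iterates of the transfer operator on the constant function `1`. -/
noncomputable def transferOne (t : ℝ) (n : ℕ) : Copies d → ℝ := (Φ.transfer t)^[n] fun _ => 1

@[simp] lemma transferOne_zero (s : Copies d) : Φ.transferOne t 0 s = 1 := rfl

lemma transferOne_succ (n : ℕ) : Φ.transferOne t (n + 1) = Φ.transfer t (Φ.transferOne t n) :=
  Function.iterate_succ_apply' _ _ _

lemma transferOne_nonneg (n : ℕ) (s : Copies d) : 0 ≤ Φ.transferOne t n s := by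
  induction n generalizing s with
  | zero => simp
  | succ n ih => rw [transferOne_succ]; exact Φ.transfer_nonneg ih s

-- The operator substitutes `T_j x` for `x`, so the new letter goes to the right end of the word,
-- next to `k`; the factor `M j k` is the admissibility of that last transition.
open Classical in
lemma transferOne_apply (n : ℕ) (k : Fin d) (x : Set.Icc (0 : ℝ) 1) :
    Φ.transferOne t n (k, x) = ∑ w ∈ wordsOfLength d n,
      if Φ.Admissible (w ++ [k]) then Φ.wordDeriv w x ^ t else 0 := by
  induction n generalizing k x with
  | zero => simp [sum_wordsOfLength_zero, Admissible]
  | succ n ih =>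
    rw [transferOne_succ, sum_wordsOfLength_add]
    simp only [sum_wordsOfLength_one, transfer]
    rw [Finset.sum_comm]
    refine Finset.sum_congr rfl fun j _ => ?_
    rw [copyMap, ih, Finset.mul_sum, Finset.sum_mul]
    refine Finset.sum_congr rfl fun w _ => ?_
    have hiff : Φ.Admissible (w ++ [j] ++ [k]) ↔ Φ.Admissible (w ++ [j]) ∧ Φ.M j k = 1 := by
      rw [Admissible, List.append_assoc, List.singleton_append, List.isChain_split]
      simp [Admissible]
    have hd : Φ.wordDeriv (w ++ [j]) x ^ t =
        Φ.wordDeriv w (Φ.T j x) ^ t * |intervalDeriv (Φ.T j) x| ^ t := by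
      rw [wordDeriv_append]
      simp only [wordMap_cons, wordMap_nil, wordDeriv_cons, wordDeriv_nil, mul_one]
      exact Real.mul_rpow (Φ.wordDeriv_pos w (Φ.mapsTo j x.2)).le (abs_nonneg _)
    rw [hd]
    rcases Φ.zero_or_one j k with h | h
    · rw [if_neg (c := Φ.Admissible (w ++ [j] ++ [k])) fun h' => by simp [(hiff.1 h').2] at h, h]
      simp
    · by_cases hw : Φ.Admissible (w ++ [j])
      · rw [if_pos hw, if_pos (hiff.2 ⟨hw, h⟩), h]; simp
      · rw [if_neg hw, if_neg fun h' => hw (hiff.1 h').1]; simp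

variable {Φ}

lemma IsDistortionConst.transferOne_le (hK : Φ.IsDistortionConst K) (ht : 0 ≤ t) (n : ℕ)
    (s : Copies d) : Φ.transferOne t n s ≤ Φ.partitionSum K t n := by
  obtain ⟨k, x⟩ := s
  rw [transferOne_apply]
  refine Finset.sum_le_sum fun w _ => ?_
  split_ifs with h
  · have hw : Φ.Admissible w := List.IsChain.left_of_append h
    rw [wordWeight, if_pos hw]
    exact Real.rpow_le_rpow (Φ.wordDeriv_pos w x.2).le (hK.wordDeriv_le w x.2) ht
  · exact hK.wordWeight_nonneg w

/-- Every admissible word can be followed by some letter `k`, so it occurs in at least one of the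
`d` components evaluated at `0`; `K ^ 2` converts derivative into size. -/
lemma IsDistortionConst.partitionSum_le [Nonempty (Fin d)] (hK : Φ.IsDistortionConst K) (ht : 0 ≤ t) (n : ℕ)
    {b : ℝ} (hb : ∀ s, Φ.transferOne t n s ≤ b) :
    Φ.partitionSum K t n ≤ (K ^ 2) ^ t * (d * b) := by
  classical
  have hK0 := hK.pos
  choose next hnext using Φ.exists_successor
  set x₀ : Set.Icc (0 : ℝ) 1 := ⟨0, zero_mem_Icc⟩ with hx₀
  have hw : ∀ w : List (Fin d), w ∈ wordsOfLength d n → Φ.wordWeight K t w ≤ (K ^ 2) ^ t *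
      ∑ k, if Φ.Admissible (w ++ [k]) then Φ.wordDeriv w x₀ ^ t else 0 := by
    intro w hw
    have hnn : ∀ k ∈ Finset.univ, 0 ≤
        if Φ.Admissible (w ++ [k]) then Φ.wordDeriv w x₀ ^ t else 0 := fun k _ => by
      split_ifs
      exacts [Real.rpow_nonneg (Φ.wordDeriv_pos w x₀.2).le _, le_rfl]
    rw [wordWeight]
    split_ifs with h
    swap
    · exact mul_nonneg (by positivity) (Finset.sum_nonneg hnn)
    obtain ⟨k, hk⟩ : ∃ k, Φ.Admissible (w ++ [k]) := by
      rcases List.eq_nil_or_concat w with rfl | ⟨v, a, rfl⟩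
      · exact ⟨Classical.arbitrary _, List.isChain_singleton _⟩
      · refine ⟨next a, ?_⟩
        rw [List.concat_eq_append] at h ⊢
        rw [Admissible, List.append_assoc, List.singleton_append, List.isChain_split]
        exact ⟨h, by simpa using hnext a⟩
    have h1 := Finset.single_le_sum hnn (Finset.mem_univ k)
    rw [if_pos hk] at h1
    refine le_trans ?_ (mul_le_mul_of_nonneg_left h1 (by positivity))
    rw [← Real.mul_rpow (by positivity) (Φ.wordDeriv_pos w x₀.2).le]
    exact Real.rpow_le_rpow (hK.wordSize_pos w).le (hK.wordSize_le w x₀.2) ht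
  calc Φ.partitionSum K t n ≤ ∑ w ∈ wordsOfLength d n, (K ^ 2) ^ t *
        ∑ k, (if Φ.Admissible (w ++ [k]) then Φ.wordDeriv w x₀ ^ t else 0) :=
      Finset.sum_le_sum hw
    _ = (K ^ 2) ^ t * ∑ k, Φ.transferOne t n (k, x₀) := by
      rw [← Finset.mul_sum, Finset.sum_comm]
      simp only [transferOne_apply]
    _ ≤ (K ^ 2) ^ t * ∑ _k : Fin d, b :=
      mul_le_mul_of_nonneg_left (Finset.sum_le_sum fun k _ => hb _) (by positivity)
    _ = _ := by simp

/-- By aperiodicity, the iterates of the transfer operator on `1` are uniformly bounded below by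
the partition sums. -/
lemma IsDistortionConst.exists_mul_partitionSum_le [Nonempty (Fin d)]
    (hK : Φ.IsDistortionConst K) (ht : 0 ≤ t) :
    ∃ (m : ℕ) (c : ℝ), 0 < c ∧ ∀ n s, c * Φ.partitionSum K t n ≤ Φ.transferOne t (n + m) s := by
  classical
  have hK0 := hK.pos
  obtain ⟨m, hm⟩ := Φ.exists_connecting_length
  obtain ⟨κ, hκ0, hκ⟩ := hK.exists_wordSize_append_ge
  have hκ' : ∀ w u : List (Fin d), κ ^ u.length * Φ.wordSize K w ≤ Φ.wordSize K (w ++ u) := by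
    intro w u
    induction u using List.reverseRecOn with
    | nil => simp
    | append_singleton u j ih =>
      rw [← List.append_assoc, List.length_append, List.length_singleton, pow_succ', mul_assoc]
      exact (mul_le_mul_of_nonneg_left ih hκ0.le).trans (hκ _ _)
  -- Connecting a word to `k` by `m` letters costs `κ ^ m` in size; `K ^ 2` passes from the size to
  -- the derivative at `x`.
  refine ⟨m, (κ ^ m / K ^ 2) ^ t, by positivity, fun n ⟨k, x⟩ => ?_⟩
  rw [transferOne_apply, sum_wordsOfLength_add, partitionSum, Finset.mul_sum]
  refine Finset.sum_le_sum fun w _ => ?_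
  have hnn : ∀ u ∈ wordsOfLength d m, 0 ≤
      if Φ.Admissible (w ++ u ++ [k]) then Φ.wordDeriv (w ++ u) x ^ t else 0 := fun u _ => by
    split_ifs
    exacts [Real.rpow_nonneg (Φ.wordDeriv_pos _ x.2).le _, le_rfl]
  rw [wordWeight]
  split_ifs with h
  swap
  · rw [mul_zero]; exact Finset.sum_nonneg hnn
  obtain ⟨u, hu, hadm⟩ : ∃ u : List (Fin d), u.length = m ∧ Φ.Admissible (w ++ u ++ [k]) := by
    rcases List.eq_nil_or_concat w with rfl | ⟨v, a, rfl⟩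
    · obtain ⟨u, hu, hadm⟩ := hm k k
      exact ⟨u, hu, hadm.tail⟩
    · obtain ⟨u, hu, hadm⟩ := hm a k
      refine ⟨u, hu, ?_⟩
      rw [List.concat_eq_append] at h ⊢
      rw [Admissible, List.append_assoc, List.append_assoc, List.singleton_append,
        List.isChain_split]
      exact ⟨h, hadm⟩
  refine le_trans ?_ (Finset.single_le_sum hnn (mem_wordsOfLength.2 hu))
  rw [if_pos hadm, ← Real.mul_rpow (by positivity) (hK.wordSize_pos w).le]
  have hwu := hκ' w u
  have hsize := hK.wordSize_pos w
  refine Real.rpow_le_rpow (by positivity) ?_ ht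
  rw [div_mul_eq_mul_div, div_le_iff₀ (by positivity), mul_comm _ (K ^ 2), ← hu]
  exact hwu.trans (hK.wordSize_le (w ++ u) x.2)

variable (Φ)

/-- Iterate the inequality, using that the operator is positive and linear, starting from `f ≤ b`.
-/
lemma le_mul_transferOne {f : Copies d → ℝ} (hf : ∀ s, f s ≤ Φ.transfer t f s) {b : ℝ}
    (hb : ∀ s, f s ≤ b) (n : ℕ) (s : Copies d) : f s ≤ b * Φ.transferOne t n s := by
  induction n generalizing s with
  | zero => simpa using hb s
  | succ n ih =>
    rw [transferOne_succ, ← transfer_const_mul]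
    exact (hf s).trans (Φ.transfer_mono ih s)

lemma mul_transferOne_le {g : Copies d → ℝ} (hg : ∀ s, Φ.transfer t g s ≤ g s) {a : ℝ}
    (ha : ∀ s, a ≤ g s) (n : ℕ) (s : Copies d) : a * Φ.transferOne t n s ≤ g s := by
  induction n generalizing s with
  | zero => simpa using ha s
  | succ n ih =>
    rw [transferOne_succ, ← transfer_const_mul]
    exact (Φ.transfer_mono ih s).trans (hg s)

/-- Raising the exponent by `e` costs at most `θ ^ e`, which is close to `1` for small `e`. This
converts a strict factor in a test inequality into room in the exponent. -/
lemma rpow_mul_transfer_le {θ : ℝ} (hθ : 0 < θ)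
    (hb : ∀ j, ∀ x ∈ Set.Icc (0 : ℝ) 1, θ ≤ |intervalDeriv (Φ.T j) x|) {e : ℝ} (he : 0 ≤ e)
    {f : Copies d → ℝ} (hf : ∀ s, 0 ≤ f s) (s : Copies d) :
    θ ^ e * Φ.transfer t f s ≤ Φ.transfer (t + e) f s := by
  rw [transfer, transfer, Finset.mul_sum]
  refine Finset.sum_le_sum fun j _ => ?_
  have h1 := hb j s.2 s.2.2
  rw [Real.rpow_add (hθ.trans_le h1), mul_comm, mul_assoc]
  refine mul_le_mul_of_nonneg_left (mul_le_mul_of_nonneg_left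
    (Real.rpow_le_rpow hθ.le h1 he) (by positivity)) (mul_nonneg (Nat.cast_nonneg _) (hf _))

end MarkovIFS

lemma exists_one_le_mul_rpow {θ c η : ℝ} (hθ : 0 < θ) (hc : 1 < c) (hη : 0 < η) :
    ∃ e, 0 < e ∧ e ≤ η ∧ 1 ≤ c * θ ^ e := by
  have h1 : Filter.Tendsto (fun e : ℝ => c * θ ^ e) (𝓝[>] 0) (𝓝 c) := by
    have : ContinuousAt (fun e : ℝ => c * θ ^ e) 0 :=
      continuousAt_const.mul (Real.continuousAt_const_rpow hθ.ne')
    have h2 := this.tendsto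
    rw [Real.rpow_zero, mul_one] at h2
    exact h2.mono_left nhdsWithin_le_nhds
  obtain ⟨e, he1, he2⟩ := ((h1.eventually_const_lt hc).and (Ioc_mem_nhdsGT hη)).exists
  exact ⟨e, he2.1, he2.2, he1.le⟩

/-! ### Hölder functions and construction of test functions -/

lemma isHolderOnCopies_iff {d : ℕ} {α : ℝ≥0} {f : Copies d → ℝ} :
    IsHolderOnCopies α f ↔ ∃ C : ℝ, 0 ≤ C ∧ ∀ j (x y : Set.Icc (0 : ℝ) 1),
      |f (j, x) - f (j, y)| ≤ C * |(x : ℝ) - y| ^ (α : ℝ) := by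
  constructor
  · intro h
    choose C hC using h
    obtain ⟨B, hB⟩ := (Set.finite_range fun j => (C j : ℝ)).bddAbove
    refine ⟨max B 0, le_max_right _ _, fun j x y => ?_⟩
    have h1 := (hC j).dist_le x y
    rw [Real.dist_eq, Subtype.dist_eq, Real.dist_eq] at h1
    exact h1.trans (mul_le_mul_of_nonneg_right ((hB ⟨j, rfl⟩).trans (le_max_left _ _))
      (by positivity))
  · rintro ⟨C, hC, h⟩ j
    refine ⟨C.toNNReal, fun x y => ?_⟩
    change _ ≤ ENNReal.ofReal C * _
    rw [edist_dist, edist_dist, ENNReal.ofReal_rpow_of_nonneg dist_nonneg α.coe_nonneg,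
      ← ENNReal.ofReal_mul hC]
    refine ENNReal.ofReal_le_ofReal ?_
    rw [Real.dist_eq, Subtype.dist_eq, Real.dist_eq]
    exact h j x y

lemma IsHolderOnCopies.continuous {d : ℕ} {α : ℝ≥0} (hα : 0 < α) {f : Copies d → ℝ}
    (hf : IsHolderOnCopies α f) : Continuous f :=
  continuous_prod_of_discrete_left.2 fun j =>
    let ⟨_, hC⟩ := hf j
    hC.continuous hα

lemma IsHolderOnCopies.const_mul {d : ℕ} {α : ℝ≥0} {f : Copies d → ℝ}
    (hf : IsHolderOnCopies α f) (c : ℝ) : IsHolderOnCopies α fun s => c * f s := by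
  intro j
  obtain ⟨C, hC⟩ := hf j
  exact ⟨_, hC.smul c⟩

lemma IsHolderOnCopies.sum {d : ℕ} {α : ℝ≥0} {ι : Type*} (F : Finset ι) {f : ι → Copies d → ℝ}
    (hf : ∀ i, IsHolderOnCopies α (f i)) : IsHolderOnCopies α fun s => ∑ i ∈ F, f i s := by
  classical
  induction F using Finset.induction_on with
  | empty => exact isHolderOnCopies_iff.2 ⟨0, le_rfl, by simp⟩
  | insert i F hi ih =>
    intro j
    obtain ⟨C, hC⟩ := hf i j
    obtain ⟨C', hC'⟩ := ih j
    simp only [Finset.sum_insert hi]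
    exact ⟨_, hC.add hC'⟩

/-- Write `x ^ t = x ^ (t - 1) * x`; as `t ≤ 1`, the first factor decreases in `x`, so for `b ≤ a`
the difference is at most `b ^ (t - 1) * (a - b)`. -/
lemma abs_rpow_sub_rpow_le {θ a b t : ℝ} (hθ : 0 < θ) (ha : θ ≤ a) (hb : θ ≤ b) (ht₀ : 0 ≤ t)
    (ht₁ : t ≤ 1) : |a ^ t - b ^ t| ≤ θ ^ (t - 1) * |a - b| := by
  wlog hab : b ≤ a generalizing a b
  · rw [abs_sub_comm, abs_sub_comm a]
    exact this hb ha (le_of_not_ge hab)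
  have ha0 := hθ.trans_le ha
  have hb0 := hθ.trans_le hb
  have hsplit : ∀ x : ℝ, 0 < x → x ^ t = x ^ (t - 1) * x := fun x hx => by
    rw [← Real.rpow_add_one hx.ne', sub_add_cancel]
  rw [abs_of_nonneg (sub_nonneg.2 (Real.rpow_le_rpow hb0.le hab ht₀)),
    abs_of_nonneg (sub_nonneg.2 hab), hsplit a ha0, hsplit b hb0]
  have h1 : a ^ (t - 1) ≤ b ^ (t - 1) := Real.rpow_le_rpow_of_nonpos hb0 hab (by linarith)
  have h2 : b ^ (t - 1) ≤ θ ^ (t - 1) := Real.rpow_le_rpow_of_nonpos hθ hb (by linarith)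
  nlinarith [mul_le_mul_of_nonneg_right h1 ha0.le, mul_le_mul_of_nonneg_right h2 (sub_nonneg.2 hab)]

namespace MarkovIFS

variable {d : ℕ} {α : ℝ≥0} (Φ : MarkovIFS d α) {K t : ℝ}

/-- The transfer operator preserves Hölder continuity. -/
lemma isHolderOnCopies_transfer (hα : 0 < α) (ht₀ : 0 ≤ t) (ht₁ : t ≤ 1) {f : Copies d → ℝ}
    (hf : IsHolderOnCopies α f) : IsHolderOnCopies α (Φ.transfer t f) := by
  obtain ⟨b, hb⟩ := isCompact_univ.exists_bound_of_continuousOn (hf.continuous hα).continuousOn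
  obtain ⟨C, hC0, hC⟩ := isHolderOnCopies_iff.1 hf
  obtain ⟨θ, Θ, hθ, hΘ, hder⟩ := Φ.exists_deriv_bounds
  choose H hH using Φ.holder_deriv
  set c : Fin d → ℝ := fun j =>
    C * Θ ^ (α : ℝ) * Θ ^ t + max b 0 * (θ ^ (t - 1) * H j) with hc
  have hc0 : ∀ j, 0 ≤ c j := fun j => by positivity
  refine isHolderOnCopies_iff.2 ⟨∑ j, c j, Finset.sum_nonneg fun j _ => hc0 j,
    fun k x y => ?_⟩
  rw [transfer, transfer, ← Finset.sum_sub_distrib, Finset.sum_mul]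
  refine (Finset.abs_sum_le_sum_abs _ _).trans (Finset.sum_le_sum fun j _ => ?_)
  set δ := |(x : ℝ) - y| ^ (α : ℝ) with hδ
  have hδ0 : 0 ≤ δ := by positivity
  set u := f (Φ.copyMap j (k, x))
  set v := f (Φ.copyMap j (k, y))
  set A := |intervalDeriv (Φ.T j) x|
  set B := |intervalDeriv (Φ.T j) y|
  have hA : A ^ t ≤ Θ ^ t := Real.rpow_le_rpow (abs_nonneg _) (hder j x x.2).2 ht₀
  have hAB : |A ^ t - B ^ t| ≤ θ ^ (t - 1) * H j * δ := by
    refine (abs_rpow_sub_rpow_le hθ (hder j x x.2).1 (hder j y y.2).1 ht₀ ht₁).trans ?_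
    rw [mul_assoc]
    refine mul_le_mul_of_nonneg_left ((abs_abs_sub_abs_le _ _).trans ?_) (by positivity)
    have := (hH j).dist_le x.2 y.2
    rwa [Real.dist_eq, Real.dist_eq] at this
  have huv : |u - v| ≤ C * Θ ^ (α : ℝ) * δ := by
    refine (hC j _ _).trans ?_
    rw [mul_assoc, hδ, ← Real.mul_rpow (by positivity) (abs_nonneg _)]
    refine mul_le_mul_of_nonneg_left (Real.rpow_le_rpow (abs_nonneg _) ?_ α.2) hC0
    obtain ⟨z, hz, h⟩ := Φ.exists_abs_wordMap_sub_eq [j] x.2 y.2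
    simp only [wordMap_cons, wordMap_nil, wordDeriv_cons, wordDeriv_nil, mul_one] at h
    exact h.trans_le (mul_le_mul_of_nonneg_right (hder j z hz).2 (abs_nonneg _))
  have hv : |v| ≤ max b 0 := (hb _ (Set.mem_univ _)).trans (le_max_left _ _)
  have hM0 : (0 : ℝ) ≤ Φ.M j k := Nat.cast_nonneg _
  have hM1 : (Φ.M j k : ℝ) ≤ 1 := by
    rcases Φ.zero_or_one j k with h | h <;> simp [h]
  have hmain : |u * A ^ t - v * B ^ t| ≤ c j * δ := by
    have heq : u * A ^ t - v * B ^ t = (u - v) * A ^ t + v * (A ^ t - B ^ t) := by ring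
    have hA0 : 0 ≤ A ^ t := by positivity
    rw [heq]
    refine (abs_add_le _ _).trans ?_
    rw [abs_mul, abs_mul, abs_of_nonneg hA0]
    calc |u - v| * A ^ t + |v| * |A ^ t - B ^ t|
        ≤ C * Θ ^ (α : ℝ) * δ * Θ ^ t + max b 0 * (θ ^ (t - 1) * H j * δ) := by gcongr
      _ = c j * δ := by rw [hc]; ring
  have heq : (Φ.M j k : ℝ) * u * A ^ t - (Φ.M j k : ℝ) * v * B ^ t =
      (Φ.M j k : ℝ) * (u * A ^ t - v * B ^ t) := by ring
  rw [heq, abs_mul, abs_of_nonneg hM0]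
  exact (mul_le_of_le_one_left (abs_nonneg _) hM1).trans hmain

/-- Weighted sums of iterates of the transfer operator on the constant function `1` give test
functions. -/
lemma exists_testFunction (hα : 0 < α) (ht₀ : 0 ≤ t) (ht₁ : t ≤ 1) {N : ℕ} (hN : N ≠ 0) {c : ℝ}
    (hc : 0 < c) : ∃ f : Copies d → ℝ, IsHolderOnCopies α f ∧ (∀ s, 0 < f s) ∧
      ∀ s, Φ.transfer t f s =
        c ^ (1 / (N : ℝ)) * (f s + (Φ.transferOne t N s / c - 1)) := by
  -- With `L` the operator, the sum of `l⁻¹ ^ n * L ^ n 1` over `n < N` telescopes: `L` multiplies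
  -- it by `l`, up to losing the term `1` and gaining `L ^ N 1 / l ^ N`. Here `l ^ N = c`.
  set l := c ^ (1 / (N : ℝ)) with hl
  have hl0 : 0 < l := Real.rpow_pos_of_pos hc _
  have hlN : l ^ N = c := by rw [hl, one_div, Real.rpow_inv_natCast_pow hc.le hN]
  have hhol : ∀ n, IsHolderOnCopies α (Φ.transferOne t n) := by
    intro n
    induction n with
    | zero => exact isHolderOnCopies_iff.2 ⟨0, le_rfl, by simp⟩
    | succ n ih => rw [transferOne_succ]; exact Φ.isHolderOnCopies_transfer hα ht₀ ht₁ ih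
  refine ⟨fun s => ∑ n ∈ Finset.range N, l⁻¹ ^ n * Φ.transferOne t n s,
    IsHolderOnCopies.sum _ fun n => (hhol n).const_mul _, fun s => ?_, fun s => ?_⟩
  · refine Finset.sum_pos' (fun n _ => mul_nonneg (by positivity) (Φ.transferOne_nonneg n s))
      ⟨0, Finset.mem_range.2 (Nat.pos_of_ne_zero hN), by simp⟩
  · rw [transfer_sum]
    have h1 : ∀ n, Φ.transfer t (fun s => l⁻¹ ^ n * Φ.transferOne t n s) s =
        l * (l⁻¹ ^ (n + 1) * Φ.transferOne t (n + 1) s) := by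
      intro n
      rw [transfer_const_mul, ← transferOne_succ, pow_succ]
      field_simp
    rw [Finset.sum_congr rfl fun n _ => h1 n, ← Finset.mul_sum]
    congr 1
    have h2 := Finset.sum_range_succ (fun n => l⁻¹ ^ n * Φ.transferOne t n s) N
    have h3 := Finset.sum_range_succ' (fun n => l⁻¹ ^ n * Φ.transferOne t n s) N
    simp only [pow_zero, transferOne_zero, mul_one] at h3
    rw [inv_pow, hlN] at h2
    rw [div_eq_inv_mul]
    linarith

/-! ### From test functions to the dimension and back -/

/-- A strict subsolution for the transfer operator bounds the dimension from below. -/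
lemma lt_dimH_limitSet [Nonempty (Fin d)] (hα : 0 < α) (ht : 0 ≤ t) {f : Copies d → ℝ}
    (hf : IsHolderOnCopies α f) (hf0 : ∀ s, 0 < f s) {c : ℝ} (hc : 1 < c)
    (h : ∀ s, c * f s ≤ Φ.transfer t f s) : ENNReal.ofReal t < dimH Φ.limitSet := by
  obtain ⟨K, hK⟩ : ∃ K, Φ.IsDistortionConst K := Φ.exists_distortion hα
  obtain ⟨θ, Θ, hθ, -, hder⟩ := Φ.exists_deriv_bounds
  obtain ⟨e, he0, -, he⟩ := exists_one_le_mul_rpow hθ hc one_pos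
  obtain ⟨b, hb⟩ := isCompact_univ.exists_bound_of_continuousOn (hf.continuous hα).continuousOn
  have hte : 0 < t + e := by linarith
  have hsub : ∀ s, f s ≤ Φ.transfer (t + e) f s := by
    intro s
    refine le_trans ?_ (Φ.rpow_mul_transfer_le hθ (fun j x hx => (hder j x hx).1) he0.le
      (fun s => (hf0 s).le) s)
    calc f s ≤ c * θ ^ e * f s := le_mul_of_one_le_left (hf0 s).le he
      _ = θ ^ e * (c * f s) := by ring
      _ ≤ _ := mul_le_mul_of_nonneg_left (h s) (by positivity)
  have hfb : ∀ s, f s ≤ b := fun s => (le_abs_self _).trans (hb s (Set.mem_univ s))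
  set s₀ : Copies d := (Classical.arbitrary _, ⟨0, zero_mem_Icc⟩)
  have hb0 : 0 < b := (hf0 s₀).trans_le (hfb s₀)
  -- At the exponent `t + e` the sums stay away from zero, so the Hausdorff measure cannot vanish
  -- there.
  have hlow : ∀ n, f s₀ / b ≤ Φ.partitionSum K (t + e) n := by
    intro n
    refine le_trans ?_ (hK.transferOne_le hte.le n s₀)
    rw [div_le_iff₀' hb0]
    exact Φ.le_mul_transferOne hsub hfb n s₀
  have hne : MeasureTheory.Measure.hausdorffMeasure ((t + e).toNNReal : ℝ) Φ.limitSet ≠ 0 := by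
    rw [Real.coe_toNNReal _ hte.le]
    intro h0
    exact absurd (ge_of_tendsto' (hK.tendsto_partitionSum hte h0) hlow)
      (not_le.2 (div_pos (hf0 s₀) hb0))
  exact ((ENNReal.ofReal_lt_ofReal_iff hte).2 (by simpa using he0)).trans_le
    (le_dimH_of_hausdorffMeasure_ne_zero hne)

/-- A strict supersolution for the transfer operator bounds the dimension from above. -/
lemma dimH_limitSet_lt [Nonempty (Fin d)] (hα : 0 < α) (ht : 0 ≤ t) {g : Copies d → ℝ}
    (hg : IsHolderOnCopies α g) (hg0 : ∀ s, 0 < g s) {c : ℝ} (hc0 : 0 < c) (hc : c < 1)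
    (h : ∀ s, Φ.transfer t g s ≤ c * g s) : dimH Φ.limitSet < ENNReal.ofReal t := by
  obtain ⟨K, hK⟩ : ∃ K, Φ.IsDistortionConst K := Φ.exists_distortion hα
  obtain ⟨θ, Θ, hθ, -, hder⟩ := Φ.exists_deriv_bounds
  have hcont := (hg.continuous hα).continuousOn (s := Set.univ)
  obtain ⟨s₁, -, hs₁⟩ := isCompact_univ.exists_isMinOn
    ⟨(Classical.arbitrary (Fin d), ⟨0, zero_mem_Icc⟩), Set.mem_univ _⟩ hcont
  have hmin : ∀ s, g s₁ ≤ g s := fun s => hs₁ (Set.mem_univ s)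
  obtain ⟨b, hb⟩ := isCompact_univ.exists_bound_of_continuousOn hcont
  have hgb : ∀ s, g s ≤ b := fun s => (le_abs_self _).trans (hb s (Set.mem_univ s))
  -- At `t = 0` a single predecessor already gives a value at least `g s₁` at the minimum point
  -- `s₁`, against the strict inequality. Positivity leaves room to lower the exponent.
  have htpos : 0 < t := by
    refine lt_of_le_of_ne ht fun ht0 => ?_
    subst ht0
    obtain ⟨a, ha⟩ := Φ.exists_predecessor s₁.1
    have h1 : g s₁ ≤ Φ.transfer 0 g s₁ := by
      have h2 := Finset.single_le_sum (s := Finset.univ)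
        (f := fun j => (Φ.M j s₁.1 : ℝ) * g (Φ.copyMap j s₁) * |intervalDeriv (Φ.T j) s₁.2| ^ (0 : ℝ))
        (fun j _ => mul_nonneg (mul_nonneg (Nat.cast_nonneg _) (hg0 _).le) (by positivity))
        (Finset.mem_univ a)
      simp only [ha, Nat.cast_one, one_mul, Real.rpow_zero, mul_one] at h2
      exact (hmin _).trans (by simpa [transfer] using h2)
    nlinarith [h s₁, hg0 s₁]
  obtain ⟨e, he0, het, he⟩ := exists_one_le_mul_rpow hθ ((one_lt_inv₀ hc0).2 hc) htpos
  have hte : 0 ≤ t - e := sub_nonneg.2 het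
  have hsuper : ∀ s, Φ.transfer (t - e) g s ≤ g s := by
    intro s
    have h1 := Φ.rpow_mul_transfer_le (t := t - e) hθ (fun j x hx => (hder j x hx).1) he0.le
      (fun s => (hg0 s).le) s
    rw [sub_add_cancel] at h1
    have h2 : Φ.transfer (t - e) g s ≤ c⁻¹ * θ ^ e * Φ.transfer (t - e) g s :=
      le_mul_of_one_le_left (Φ.transfer_nonneg (fun s => (hg0 s).le) s) he
    calc _ ≤ c⁻¹ * (θ ^ e * Φ.transfer (t - e) g s) := by rwa [← mul_assoc]
      _ ≤ c⁻¹ * (c * g s) := mul_le_mul_of_nonneg_left (h1.trans (h s)) (by positivity)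
      _ = g s := by field_simp
  have hone : ∀ n s, Φ.transferOne (t - e) n s ≤ b / g s₁ := by
    intro n s
    rw [le_div_iff₀' (hg0 s₁)]
    exact (Φ.mul_transferOne_le hsuper hmin n s).trans (hgb s)
  have hdim : dimH Φ.limitSet ≤ (t - e).toNNReal := by
    refine hK.dimH_limitSet_le _ ((K ^ 2) ^ (t - e) * (d * (b / g s₁))) fun n => ?_
    rw [Real.coe_toNNReal _ hte]
    exact hK.partitionSum_le hte n (hone n)
  exact hdim.trans_lt ((ENNReal.ofReal_lt_ofReal_iff htpos).2 (by simpa using he0))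

/-- A lower bound for the dimension gives a strict subsolution for the transfer operator. -/
lemma exists_subsolution [Nonempty (Fin d)] (hα : 0 < α) (ht₀ : 0 ≤ t) (ht₁ : t ≤ 1)
    (h : ENNReal.ofReal t < dimH Φ.limitSet) : ∃ f : Copies d → ℝ, IsHolderOnCopies α f ∧
      (∀ s, 0 < f s) ∧ ∃ c : ℝ, 1 < c ∧ ∀ s, c * f s ≤ Φ.transfer t f s := by
  obtain ⟨K, hK⟩ : ∃ K, Φ.IsDistortionConst K := Φ.exists_distortion hα
  obtain ⟨m, c, hc, hmc⟩ := hK.exists_mul_partitionSum_le ht₀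
  -- Otherwise the sums are bounded and the dimension is at most `t`. The threshold makes the
  -- iterate of order `n + m` on `1` at least `2`.
  obtain ⟨n, hn⟩ : ∃ n, 2 / c < Φ.partitionSum K t n := by
    by_contra! hcon
    refine absurd h (not_lt.2 ?_)
    have h1 := hK.dimH_limitSet_le t.toNNReal (2 / c)
      (by rwa [Real.coe_toNNReal t ht₀])
    exact h1
  have h2 : ∀ s, 2 ≤ Φ.transferOne t (n + m) s := fun s => by
    rw [div_lt_iff₀' hc] at hn
    exact hn.le.trans (hmc n s)
  have hN : n + m ≠ 0 := by
    intro h0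
    have h3 := h2 (Classical.arbitrary _, ⟨0, zero_mem_Icc⟩)
    rw [h0, transferOne_zero] at h3
    norm_num at h3
  obtain ⟨f, hf, hf0, hft⟩ := Φ.exists_testFunction hα ht₀ ht₁ hN two_pos
  refine ⟨f, hf, hf0, _, Real.one_lt_rpow one_lt_two (z := 1 / ((n + m : ℕ) : ℝ))
    (by positivity), fun s => ?_⟩
  rw [hft]
  refine mul_le_mul_of_nonneg_left ?_ (by positivity)
  linarith [h2 s]

/-- An upper bound for the dimension gives a strict supersolution for the transfer operator. -/
lemma exists_supersolution [Nonempty (Fin d)] (hα : 0 < α) (ht₁ : t ≤ 1)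
    (h : dimH Φ.limitSet < ENNReal.ofReal t) : ∃ g : Copies d → ℝ, IsHolderOnCopies α g ∧
      (∀ s, 0 < g s) ∧ ∃ c : ℝ, c < 1 ∧ ∀ s, Φ.transfer t g s ≤ c * g s := by
  obtain ⟨K, hK⟩ : ∃ K, Φ.IsDistortionConst K := Φ.exists_distortion hα
  have ht : 0 < t := ENNReal.ofReal_pos.1 (pos_of_gt h)
  have h0 : MeasureTheory.Measure.hausdorffMeasure ((t.toNNReal : ℝ≥0) : ℝ) Φ.limitSet = 0 :=
    hausdorffMeasure_of_dimH_lt h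
  rw [Real.coe_toNNReal t ht.le] at h0
  obtain ⟨N, hN, hN1⟩ := (((hK.tendsto_partitionSum ht h0).eventually_lt_const
    (half_pos one_pos)).and (Filter.eventually_ge_atTop 1)).exists
  have hN0 : N ≠ 0 := by omega
  obtain ⟨g, hg, hg0, hgt⟩ := Φ.exists_testFunction hα ht.le ht₁ hN0 (half_pos one_pos)
  refine ⟨g, hg, hg0, _, Real.rpow_lt_one (x := 1 / 2) (by norm_num) (by norm_num)
    (z := 1 / (N : ℝ)) (by positivity), fun s => ?_⟩
  rw [hgt]
  refine mul_le_mul_of_nonneg_left ?_ (by positivity)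
  linarith [(hK.transferOne_le ht.le N s).trans hN.le]

end MarkovIFS

theorem mainTheorem4 {d : ℕ} (hd : 2 ≤ d) {α : ℝ≥0} (hα₀ : 0 < α) (hα₁ : α ≤ 1)
    (Φ : MarkovIFS d α) (t₀ t₁ : ℝ) (ht₀ : t₀ ∈ Set.Icc (0 : ℝ) 1)
    (ht₁ : t₁ ∈ Set.Icc (0 : ℝ) 1) :
    dimH Φ.limitSet ∈ Set.Ioo (ENNReal.ofReal t₀) (ENNReal.ofReal t₁) ↔
      ∃ f g : Copies d → ℝ,
        (IsHolderOnCopies α f ∧ ∀ s, 0 < f s) ∧ (IsHolderOnCopies α g ∧ ∀ s, 0 < g s) ∧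
        1 < (⨅ s : Copies d, Φ.transfer t₀ f s / f s) ∧
        (⨆ s : Copies d, Φ.transfer t₁ g s / g s) < 1 := by
  have : Nonempty (Fin d) := ⟨⟨0, by omega⟩⟩
  have : Nonempty (Copies d) := ⟨(Classical.arbitrary _, ⟨0, MarkovIFS.zero_mem_Icc⟩)⟩
  constructor
  · rintro ⟨h0, h1⟩
    obtain ⟨f, hf, hf0, c, hc, hfc⟩ := Φ.exists_subsolution hα₀ ht₀.1 ht₀.2 h0
    obtain ⟨g, hg, hg0, c', hc', hgc⟩ := Φ.exists_supersolution hα₀ ht₁.2 h1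
    refine ⟨f, g, ⟨hf, hf0⟩, ⟨hg, hg0⟩, hc.trans_le (le_ciInf fun s => ?_),
      (ciSup_le fun s => ?_).trans_lt hc'⟩
    · exact (le_div_iff₀ (hf0 s)).2 (hfc s)
    · exact (div_le_iff₀ (hg0 s)).2 (hgc s)
  · rintro ⟨f, g, ⟨hf, hf0⟩, ⟨hg, hg0⟩, h0, h1⟩
    constructor
    · refine Φ.lt_dimH_limitSet hα₀ ht₀.1 hf hf0 h0 fun s => ?_
      rw [← le_div_iff₀ (hf0 s)]
      -- A real infimum bounds the values only if they are bounded below; here by `0`.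
      refine ciInf_le ⟨0, ?_⟩ s
      rintro _ ⟨s, rfl⟩
      exact div_nonneg (Φ.transfer_nonneg (fun s => (hf0 s).le) s) (hf0 s).le
    · have hcont : Continuous fun s => Φ.transfer t₁ g s / g s :=
        ((Φ.isHolderOnCopies_transfer hα₀ ht₁.1 ht₁.2 hg).continuous hα₀).div
          (hg.continuous hα₀) fun s => (hg0 s).ne'
      -- Needed because the supremum of an unbounded real set is `0` by convention; it follows from
      -- continuity on a compact space.
      have hbdd : BddAbove (Set.range fun s => Φ.transfer t₁ g s / g s) :=
        (isCompact_range hcont).bddAbove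
      -- The maximum with `0` makes `c` positive, since `c⁻¹` is used for the upper bound.
      obtain ⟨c, hc1, hc2⟩ := exists_between (max_lt h1 one_pos)
      refine Φ.dimH_limitSet_lt hα₀ ht₁.1 hg hg0 ((le_max_right _ _).trans_lt hc1) hc2
        fun s => ?_
      rw [← div_le_iff₀ (hg0 s)]
      exact (le_ciSup hbdd s).trans ((le_max_left _ _).trans hc1.le)
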